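/- Let $n,m\ge 0$ be integers, let $U\subset\mathbb C^{n+1}$ be an open neighbourhood of $0$ with coordinates $Z=(z,w)\in\mathbb C^n\times\mathbb C$, and let $\rho(Z,\bar Z)$ be a real-valued real-analytic function on $U$ whose complexification $\rho(Z,\chi)$ is holomorphic for $(Z,\bar\chi)\in U\times U$. Assume $\rho(0,0)=0$ and $\rho_w(0,0)\ne0$, and let $M=\{Z\in U:\rho(Z,\bar Z)=0\}$. For $\beta\in\mathbb N^n$, $s\in\mathbb N$ (with $0\in\mathbb N$) write $$\rho_{z^\beta w^s}=\frac{\partial^{|\beta|+s}\rho}{\partial z_1^{\beta_1}\cdots\partial z_n^{\beta_n}\partial w^s}$$ and assign to this derivative the weight $\mathrm{wt}\,\rho_{z^\beta w^s}=2|\beta|+s-1$. The weight of a polynomial in these derivatives (regarded as independent variables) is the maximal total weight of its monomials, and $\deg_{\rho_w}$ denotes its degree in the variable $\rho_w$. Let $S_0=\{Z\in U:\rho(Z,0)=0\}$ be the Segre variety of $0$, and assume that $S_0$ is irreducible, i.e. that the set of points of $S_0$ where the differential of $Z\mapsto\rho(Z,0)$ does not vanish is connected and dense in $S_0$ (if that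 differential vanishes nowhere on $S_0$, this says that $S_0$ is connected). A real hyperquadric in $\mathbb C^{N+1}$ is a hypersurface $M'=\{\mathrm{Im}\,w=h(z,\bar z)\}$ in some linear coordinates $(z,w)\in\mathbb C^N\times\mathbb C$, with $h$ a (possibly degenerate) hermitian form. Suppose that, for some hyperquadric $M'\subset\mathbb C^{n+m+1}$, there is a holomorphic embedding $H$ of a neighbourhood of $M$ in $\mathbb C^{n+1}$ into $\mathbb C^{n+m+1}$ such that $H(M)\subset M'$ and $H_*(T_x\mathbb C^{n+1})+T_{H(x)}M'=T_{H(x)}\mathbb C^{n+m+1}$ for all $x\in M$. Then for any $m+1$ multiindices $\alpha_1,\dots,\alpha_{m+1}\in\mathbb N^n$ with $|\alpha_j|\ge2$ there exists an integer $k$ with $K:=\{j:|\alpha_j|=k\}\neq\emptyset$ such that $$\sum_{j\in K}P_j\big(\rho_{z^\beta w^s}(0,\bar\zeta)\big)\,\rho_{z^{\alpha_j}}(0,\bar\zeta)=R\big(\rho_{z^\beta w^s}(0,\bar\zeta)\big),\qquad\zeta\in S_0,$$ where $P_j$ ($j\in K$) and $R$ are polynomials with complex coefficients in the derivatives $\rho_{z^\beta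 w^s}(0,\bar\zeta)$ with $0<|\beta|+s\le k$ and $|\beta|<k$, and not all of the functions $P_j(\rho_{z^\beta w^s}(0,\bar\zeta))$, $j\in K$, vanish identically in $\zeta\in S_0$. Moreover, $P_j$ and $R$ can be chosen so that $$\mathrm{wt}\,P_j\le(2k-2)(l-1),\quad \mathrm{wt}\,R\le(2k-2)l+1,\quad \deg_{\rho_w}P_j\le(2k-2)l,\quad \deg_{\rho_w}R\le(2k-2)l+1,$$ where $l\ge1$ is the number of all $j$ with $|\alpha_j|\le k$. -/

import Mathlib

namespace Segre

/-- The space `ℂⁿ × ℂ` with coordinates `Z = (z, w)`. -/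
abbrev Cz (n : ℕ) : Type := (Fin n → ℂ) × ℂ

/-! ### Partial derivatives -/

/-- The holomorphic partial derivative `∂f/∂z_j`. -/
noncomputable def dz {n : ℕ} (j : Fin n) (f : Cz n → ℂ) : Cz n → ℂ :=
  fun Z => fderiv ℂ f Z (Pi.single j 1, 0)

/-- The holomorphic partial derivative `∂f/∂w`. -/
noncomputable def dw {n : ℕ} (f : Cz n → ℂ) : Cz n → ℂ :=
  fun Z => fderiv ℂ f Z (0, 1)

/-- The mixed derivative `f_{z^β w^s} = ∂^{|β|+s} f / ∂z_1^{β_1} ⋯ ∂z_n^{β_n} ∂w^s`. -/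
noncomputable def mixedPartial {n : ℕ} (β : Fin n → ℕ) (s : ℕ) (f : Cz n → ℂ) : Cz n → ℂ :=
  (List.finRange n).foldr (fun j g => (dz j)^[β j] g) (dw^[s] f)

/-- The order `|β| = β_1 + ⋯ + β_n` of a multiindex. -/
def order {n : ℕ} (β : Fin n → ℕ) : ℕ := ∑ i, β i

/-! ### Hypersurfaces and Segre varieties

A defining function on `U` is given through its complexification `ρ Z χ`, where `χ` stands for
the conjugate variable `Z̄`. Complex conjugation on `ℂⁿ × ℂ` is `star`. -/

/-- `ρ` is (the complexification of) a real-analytic function `ρ(Z, Z̄)` on `U`: it is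
holomorphic in `(Z, χ) ∈ U × Ū`, and its restriction to `χ = Z̄` is real-valued. -/
structure IsComplexifiedRealAnalytic {n : ℕ} (U : Set (Cz n)) (ρ : Cz n → Cz n → ℂ) : Prop where
  holo : DifferentiableOn ℂ (fun p : Cz n × Cz n => ρ p.1 p.2) (U ×ˢ {χ | star χ ∈ U})
  real : ∀ Z ∈ U, (ρ Z (star Z)).im = 0

/-- The real hypersurface `M = {Z ∈ U : ρ(Z, Z̄) = 0}`. -/
def hypersurface {n : ℕ} (U : Set (Cz n)) (ρ : Cz n → Cz n → ℂ) : Set (Cz n) :=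
  {Z | Z ∈ U ∧ ρ Z (star Z) = 0}

/-- The Segre variety `S_ζ = {Z ∈ U : ρ(Z, ζ̄) = 0}` of the point `ζ`. -/
def segreVariety {n : ℕ} (U : Set (Cz n)) (ρ : Cz n → Cz n → ℂ) (ζ : Cz n) : Set (Cz n) :=
  {Z | Z ∈ U ∧ ρ Z (star ζ) = 0}

/-- The points of `S_ζ` at which the differential of its defining equation does not vanish. -/
def segreRegular {n : ℕ} (U : Set (Cz n)) (ρ : Cz n → Cz n → ℂ) (ζ : Cz n) : Set (Cz n) :=
  {Z | Z ∈ segreVariety U ρ ζ ∧ fderiv ℂ (fun Z' => ρ Z' (star ζ)) Z ≠ 0}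

/-- `S_ζ` is irreducible (and its equation is generically reduced): the regular points form a
connected dense subset. If all points of `S_ζ` are regular, this says that the complex
submanifold `S_ζ` is connected. -/
def SegreIrreducible {n : ℕ} (U : Set (Cz n)) (ρ : Cz n → Cz n → ℂ) (ζ : Cz n) : Prop :=
  IsConnected (segreRegular U ρ ζ) ∧ segreVariety U ρ ζ ⊆ closure (segreRegular U ρ ζ)

/-! ### Hyperquadrics and transversal embeddings -/

/-- The function `Im w - h(z, z̄)` on `ℂ^{N+1}`, where `(z, w) = L Z` are linear coordinates and
`h(z, z̄) = ∑ z̄_i A_{ij} z_j` (real for hermitian `A`). -/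
noncomputable def quadricFn {N : ℕ} (L : (Fin (N + 1) → ℂ) ≃L[ℂ] (Fin N → ℂ) × ℂ)
    (A : Matrix (Fin N) (Fin N) ℂ) (Z : Fin (N + 1) → ℂ) : ℝ :=
  (L Z).2.im - (∑ i, ∑ j, star ((L Z).1 i) * A i j * (L Z).1 j).re

/-- The real hyperquadric `Im w = h(z, z̄)` in the linear coordinates `L`. -/
def hyperquadric {N : ℕ} (L : (Fin (N + 1) → ℂ) ≃L[ℂ] (Fin N → ℂ) × ℂ)
    (A : Matrix (Fin N) (Fin N) ℂ) : Set (Fin (N + 1) → ℂ) :=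
  {Z | quadricFn L A Z = 0}

/-- The real tangent space of the hyperquadric at the point `p`. -/
noncomputable def hyperquadricTangent {N : ℕ} (L : (Fin (N + 1) → ℂ) ≃L[ℂ] (Fin N → ℂ) × ℂ)
    (A : Matrix (Fin N) (Fin N) ℂ) (p : Fin (N + 1) → ℂ) : Submodule ℝ (Fin (N + 1) → ℂ) :=
  LinearMap.ker (fderiv ℝ (quadricFn L A) p).toLinearMap

/-- `H` is a holomorphic embedding of the open set `Ω`. -/
structure IsHolomorphicEmbedding {n N : ℕ} (Ω : Set (Cz n)) (H : Cz n → (Fin N → ℂ)) : Prop where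
  holo : DifferentiableOn ℂ H Ω
  immersion : ∀ x ∈ Ω, Function.Injective (fderiv ℂ H x)
  embedding : Topology.IsEmbedding (Ω.domRestrict H)

/-- `M ⊂ ℂ^{n+1}` is transversally holomorphically embeddable into some hyperquadric `M'` of
`ℂ^{N+1}`: a neighbourhood of `M` has a holomorphic embedding `H` into `ℂ^{N+1}` with
`H(M) ⊂ M'` and `H_*(T_x ℂ^{n+1}) + T_{H(x)} M' = T_{H(x)} ℂ^{N+1}` for all `x ∈ M`. -/
def TransversallyEmbeddable {n : ℕ} (M : Set (Cz n)) (N : ℕ) : Prop :=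
  ∃ (L : (Fin (N + 1) → ℂ) ≃L[ℂ] (Fin N → ℂ) × ℂ) (A : Matrix (Fin N) (Fin N) ℂ),
    A.IsHermitian ∧
    ∃ (Ω : Set (Cz n)) (H : Cz n → (Fin (N + 1) → ℂ)),
      IsOpen Ω ∧ M ⊆ Ω ∧ IsHolomorphicEmbedding Ω H ∧ Set.MapsTo H M (hyperquadric L A) ∧
      ∀ x ∈ M, LinearMap.range ((fderiv ℂ H x).restrictScalars ℝ).toLinearMap ⊔
        hyperquadricTangent L A (H x) = ⊤

/-! ### Polynomials in the derivatives of the defining function -/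

/-- Polynomials in formal variables, one for every derivative `ρ_{z^β w^s}`. -/
abbrev JetPoly (n : ℕ) : Type := MvPolynomial ((Fin n → ℕ) × ℕ) ℂ

/-- The value of a polynomial in the derivatives `ρ_{z^β w^s}(0, ζ̄)`. -/
noncomputable def JetPoly.evalAt {n : ℕ} (P : JetPoly n) (ρ : Cz n → Cz n → ℂ) (ζ : Cz n) : ℂ :=
  MvPolynomial.eval (fun v => mixedPartial v.1 v.2 (fun Z => ρ Z (star ζ)) 0) P

/-- Only derivatives `ρ_{z^β w^s}` with `0 < |β| + s ≤ k` and `|β| < k` occur in `P`. -/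
def JetPoly.LowerOrder {n : ℕ} (P : JetPoly n) (k : ℕ) : Prop :=
  ∀ v ∈ P.vars, 0 < order v.1 + v.2 ∧ order v.1 + v.2 ≤ k ∧ order v.1 < k

/-- The weight of a polynomial, the variable `ρ_{z^β w^s}` having weight `2|β| + s - 1`
(used only for `|β| + s > 0`, so the subtraction is not truncated). -/
noncomputable def JetPoly.wt {n : ℕ} (P : JetPoly n) : ℕ :=
  MvPolynomial.weightedTotalDegree (fun v : (Fin n → ℕ) × ℕ => 2 * order v.1 + v.2 - 1) P

/-- The degree of a polynomial in the variable `ρ_w`. -/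
noncomputable def JetPoly.degW {n : ℕ} (P : JetPoly n) : ℕ :=
  MvPolynomial.degreeOf (0, 1) P

end Segre

/-! Let Q(Z, χ) be the complexified defining function of the quadric, pulled back by H. Since the
hermitian form is sesquilinear, Q(Z, χ) = ν_χ(H(Z)) - b(χ) with a linear form ν_χ: for fixed χ it is
affine in H(Z). It vanishes on M, hence on {ρ(Z, χ) = 0} near the origin
(`exists_eq_zero_of_eq_zero_on_hypersurface`). For ζ in S_0 near 0 put χ = ζ̄; reality of ρ gives
ρ(0, χ) = 0, so near 0 the function F = Q(·, χ) vanishes on the hypersurface {f = 0}, f = ρ(·, χ),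
which passes through 0.

Implicit differentiation along this hypersurface (`exists_tangential_relation`) gives for each α a
relation f_w · L_α(F) + (E_α - f_w^(2|α|-2) f_{z^α}) F_w = 0, where E_α and the coefficients of L_α
are universal polynomials in lower derivatives of f. At Z = 0 every derivative of F is ν_χ of a
derivative vector of H, and that vector does not depend on χ. So L_α(F) = ν_χ(V_α), where V_α is a
vector in ℂ^(n+m+1) with entries polynomial in the derivatives of ρ.

On the (n+1)-dimensional image of T = dH(0) the form ν_χ is known up to the factor ν_χ(T ∂_w), which
is nonzero near χ = 0 by transversality. Modulo this image the m+1 vectors V_α lie in a space of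
dimension m and are dependent. `exists_minimal_dependent` and `exists_minor_relation` express the
dependence by minors, the coefficient of some vector of the top order k not being identically zero.
Substituting into the relations and cancelling ν_χ(T ∂_w) leaves an identity between derivatives of
ρ alone (`exists_polynomial_relation`). Order, weight and degree are tracked by the filtration
`jetLE`.

The identity is antiholomorphic in ζ, so it spreads from a neighbourhood of 0 to all of S_0 by
irreducibility (`eqOn_zero_of_irreducible`). -/

open Set Filter Topology Metric MeasureTheory

namespace Segre

/-! ### Holomorphic functions of several variables: smoothness and iterated directional derivatives.
-/

section Holomorphic

variable {E : Type*} [NormedAddCommGroup E] [NormedSpace ℂ E]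

/-- The derivative of `f` in the direction `v`. -/
noncomputable def dirDeriv (v : E) (f : E → ℂ) : E → ℂ := fun x => fderiv ℂ f x v

/-- The kernel of the Cauchy formula for the first derivative. -/
noncomputable def cauchyKernel (r θ : ℝ) : ℂ :=
  (2 * Real.pi * Complex.I)⁻¹ * (deriv (circleMap 0 r) θ * (1 / (circleMap 0 r θ - 0) ^ (1 + 1)))

lemma continuous_cauchyKernel {r : ℝ} (hr : 0 < r) : Continuous (cauchyKernel r) := by
  unfold cauchyKernel
  simp only [deriv_circleMap]
  refine continuous_const.mul (Continuous.mul (by fun_prop) ?_)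
  refine continuous_const.div (by fun_prop) fun θ => ?_
  simp [circleMap, hr.ne']

lemma dirDeriv_eq_integral {f : E → ℂ} {x v : E} {r : ℝ} (hr : 0 < r)
    (hf : ∀ t : ℂ, ‖t‖ ≤ r → DifferentiableAt ℂ f (x + t • v)) :
    dirDeriv v f x = ∫ θ in (0 : ℝ)..2 * Real.pi,
      cauchyKernel r θ * f (x + circleMap 0 r θ • v) := by
  have h1 : DiffContOnCl ℂ (fun t : ℂ => f (x + t • v)) (ball 0 r) := by
    refine DifferentiableOn.diffContOnCl fun t ht => ?_
    rw [closure_ball _ hr.ne'] at ht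
    have h := hf t (by simpa using ht)
    exact (DifferentiableAt.comp t (f := fun t : ℂ => x + t • v) h
      (by fun_prop)).differentiableWithinAt
  have h2 := h1.circleIntegral_one_div_sub_center_pow_smul hr 1
  have h3 : deriv (fun t : ℂ => f (x + t • v)) 0 = dirDeriv v f x := by
    have h := hf 0 (by simpa using hr.le)
    have h4 : HasDerivAt (fun t : ℂ => x + t • v) v 0 := by
      simpa using ((hasDerivAt_id (0 : ℂ)).smul_const v).const_add x
    have := (h.hasFDerivAt).comp_hasDerivAt (0 : ℂ) h4
    simpa [Function.comp_def, dirDeriv] using this.deriv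
  rw [iteratedDeriv_one, h3] at h2
  have h5 : (2 * (Real.pi : ℂ) * Complex.I) ≠ 0 := by simp [Real.pi_ne_zero]
  simp only [Nat.factorial_one, Nat.cast_one, div_one, smul_eq_mul] at h2
  rw [← mul_right_inj' h5, ← h2, circleIntegral, ← intervalIntegral.integral_const_mul]
  congr 1
  ext θ
  simp only [cauchyKernel, smul_eq_mul]
  field_simp

/-- The partial derivatives of a holomorphic function of several variables are holomorphic. -/
lemma differentiableOn_dirDeriv [FiniteDimensional ℂ E] {O : Set E} (hO : IsOpen O) {f : E → ℂ}
    (hf : DifferentiableOn ℂ f O) (v : E) : DifferentiableOn ℂ (dirDeriv v f) O := by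
  intro x₀ hx₀
  apply DifferentiableAt.differentiableWithinAt
  obtain ⟨R, hR, hRO, hM⟩ : ∃ R > 0, ball x₀ R ⊆ O ∧ ∀ y ∈ ball x₀ R, ‖f y‖ ≤ ‖f x₀‖ + 1 := by
    have h1 : ∀ᶠ y in 𝓝 x₀, y ∈ O := hO.mem_nhds hx₀
    have h2 : ∀ᶠ y in 𝓝 x₀, ‖f y‖ < ‖f x₀‖ + 1 :=
      (hf.differentiableAt (hO.mem_nhds hx₀)).continuousAt.norm.eventually_lt
        continuousAt_const (by simp)
    obtain ⟨R, hR, h⟩ := Metric.eventually_nhds_iff_ball.1 (h1.and h2)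
    exact ⟨R, hR, fun y hy => (h y hy).1, fun y hy => (h y hy).2.le⟩
  set M := ‖f x₀‖ + 1
  -- Circles of this radius in the direction v around points of the ball of radius R/4 stay in the
  -- ball of radius R/2, where the Cauchy estimate bounds `fderiv`. This allows differentiation
  -- under the Cauchy integral.
  obtain ⟨r, hr, hrv⟩ : ∃ r > 0, r * ‖v‖ < R / 4 := by
    refine ⟨R / 4 / (‖v‖ + 1), by positivity, ?_⟩
    rw [div_mul_eq_mul_div, div_lt_iff₀ (by positivity)]
    nlinarith [norm_nonneg v]
  have hmem : ∀ x ∈ ball x₀ (R / 4), ∀ t : ℂ, ‖t‖ ≤ r → x + t • v ∈ ball x₀ (R / 2) := by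
    intro x hx t ht
    rw [mem_ball, dist_eq_norm] at hx ⊢
    have : ‖t • v‖ ≤ r * ‖v‖ := by rw [norm_smul]; gcongr
    calc ‖x + t • v - x₀‖ = ‖(x - x₀) + t • v‖ := by congr 1; abel
      _ ≤ ‖x - x₀‖ + ‖t • v‖ := norm_add_le _ _
      _ < R / 2 := by linarith
  have hdiff : ∀ y ∈ ball x₀ R, DifferentiableAt ℂ f y := fun y hy =>
    hf.differentiableAt (hO.mem_nhds (hRO hy))
  have hhalf : ball x₀ (R / 2) ⊆ ball x₀ R := ball_subset_ball (by linarith)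
  have hbound : ∀ y ∈ ball x₀ (R / 2), ‖fderiv ℂ f y‖ ≤ 2 * M / (R / 2) := by
    intro y hy
    have hsub : ball y (R / 2) ⊆ ball x₀ R := by
      apply ball_subset_ball'
      rw [mem_ball] at hy
      linarith
    refine Complex.norm_fderiv_le_div_of_mapsTo_ball (hf.mono (hsub.trans hRO)) ?_ (by positivity)
    intro z hz
    rw [mem_closedBall, dist_eq_norm]
    have := norm_sub_le (f z) (f y)
    linarith [hM z (hsub hz), hM y (hhalf hy)]
  have hcirc : ∀ θ, ‖circleMap 0 r θ‖ ≤ r := fun θ => by simp [abs_of_pos hr]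
  have hker := continuous_cauchyKernel hr
  have : ProperSpace (E →L[ℂ] ℂ) := FiniteDimensional.proper ℂ _
  have : ProperSpace E := FiniteDimensional.proper ℂ _
  let _ : MeasurableSpace E := borel E
  have : BorelSpace E := ⟨rfl⟩
  have hcont : ∀ x ∈ ball x₀ (R / 4),
      Continuous fun θ => cauchyKernel r θ * f (x + circleMap 0 r θ • v) := by
    intro x hx
    refine hker.mul (continuous_iff_continuousAt.2 fun θ => ?_)
    exact ContinuousAt.comp (f := fun θ : ℝ => x + circleMap 0 r θ • v)
      (hdiff _ (hhalf (hmem x hx _ (hcirc θ)))).continuousAt (by fun_prop)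
  have hx₀' : x₀ ∈ ball x₀ (R / 4) := mem_ball_self (by positivity)
  have key := intervalIntegral.hasFDerivAt_integral_of_dominated_of_fderiv_le
    (μ := volume) (a := 0) (b := 2 * Real.pi) (𝕜 := ℂ)
    (F := fun x θ => cauchyKernel r θ * f (x + circleMap 0 r θ • v))
    (F' := fun x θ => cauchyKernel r θ • fderiv ℂ f (x + circleMap 0 r θ • v)) (x₀ := x₀)
    (bound := fun θ => ‖cauchyKernel r θ‖ * (2 * M / (R / 2)))
    (isOpen_ball.mem_nhds hx₀') ?_ ?_ ?_ ?_ ?_ ?_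
  · refine (key.differentiableAt).congr_of_eventuallyEq ?_
    filter_upwards [isOpen_ball.mem_nhds hx₀'] with x hx
    exact dirDeriv_eq_integral hr fun t ht => hdiff _ (hhalf (hmem x hx t ht))
  · filter_upwards [isOpen_ball.mem_nhds hx₀'] with x hx
    exact (hcont x hx).aestronglyMeasurable
  · exact (hcont x₀ hx₀').intervalIntegrable _ _
  -- Continuity of `fderiv ℂ f` is not available yet; measurability is enough for dominated
  -- differentiation.
  · refine (hker.aestronglyMeasurable).smul ?_
    refine Measurable.aestronglyMeasurable ?_
    exact (measurable_fderiv ℂ f).comp (Continuous.measurable (by fun_prop))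
  · refine Eventually.of_forall fun θ _ x hx => ?_
    rw [norm_smul]
    gcongr
    exact hbound _ (hmem x hx _ (hcirc θ))
  · exact (hker.norm.mul continuous_const).intervalIntegrable _ _
  · refine Eventually.of_forall fun θ _ x hx => ?_
    have h := (hdiff _ (hhalf (hmem x hx _ (hcirc θ)))).hasFDerivAt
    have h2 : HasFDerivAt (fun x => x + circleMap 0 r θ • v) (ContinuousLinearMap.id ℂ E) x :=
      (hasFDerivAt_id x).add_const _
    have := (HasFDerivAt.comp (f := fun x => x + circleMap 0 r θ • v) x h h2).const_smul
      (cauchyKernel r θ)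
    simpa [Function.comp_def] using! this

/-- In finite dimension `fderiv` is as smooth as all directional derivatives, and these are again
holomorphic, so one order of smoothness is gained at each induction step. -/
lemma contDiffOn_of_differentiableOn [FiniteDimensional ℂ E] {O : Set E} (hO : IsOpen O) (k : ℕ) :
    ∀ {f : E → ℂ}, DifferentiableOn ℂ f O → ContDiffOn ℂ k f O := by
  induction k with
  | zero => intro f hf; exact contDiffOn_zero.2 hf.continuousOn
  | succ k ih =>
    intro f hf
    rw [Nat.cast_succ, contDiffOn_succ_iff_fderiv_of_isOpen hO]
    refine ⟨hf, by simp, contDiffOn_clm_apply.2 fun v => ih (differentiableOn_dirDeriv hO hf v)⟩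

lemma contDiffAt_of_differentiableOn [FiniteDimensional ℂ E] {O : Set E} (hO : IsOpen O)
    {f : E → ℂ} (hf : DifferentiableOn ℂ f O) {x : E} (hx : x ∈ O) (k : ℕ) :
    ContDiffAt ℂ k f x :=
  (contDiffOn_of_differentiableOn hO k hf).contDiffAt (hO.mem_nhds hx)

lemma dirDeriv_congr {O : Set E} (hO : IsOpen O) {f g : E → ℂ} (h : EqOn f g O) (v : E) :
    EqOn (dirDeriv v f) (dirDeriv v g) O := by
  intro x hx
  have : f =ᶠ[𝓝 x] g := by filter_upwards [hO.mem_nhds hx] with y hy using h hy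
  simp only [dirDeriv, this.fderiv_eq]

lemma dirDeriv_comm [FiniteDimensional ℂ E] {O : Set E} (hO : IsOpen O) {f : E → ℂ}
    (hf : DifferentiableOn ℂ f O) (u v : E) :
    EqOn (dirDeriv u (dirDeriv v f)) (dirDeriv v (dirDeriv u f)) O := by
  intro x hx
  have h2 : ContDiffAt ℂ (2 : ℕ) f x := contDiffAt_of_differentiableOn hO hf hx 2
  have hs : IsSymmSndFDerivAt ℂ f x := h2.isSymmSndFDerivAt (by simp)
  have hd : DifferentiableAt ℂ (fderiv ℂ f) x :=
    (h2.fderiv_right (m := 1) (by norm_num)).differentiableAt (by simp)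
  have : ∀ a b : E, dirDeriv a (dirDeriv b f) x = fderiv ℂ (fderiv ℂ f) x a b := by
    intro a b
    unfold dirDeriv
    rw [fderiv_clm_apply hd (by fun_prop)]
    simp
  rw [this, this, hs.eq]

/-- The iterated derivative in a list of directions. -/
noncomputable def iterDeriv (l : List E) (f : E → ℂ) : E → ℂ := l.foldr dirDeriv f

@[simp] lemma iterDeriv_nil (f : E → ℂ) : iterDeriv [] f = f := rfl

@[simp] lemma iterDeriv_cons (v : E) (l : List E) (f : E → ℂ) :
    iterDeriv (v :: l) f = dirDeriv v (iterDeriv l f) := rfl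

lemma iterDeriv_append (l l' : List E) (f : E → ℂ) :
    iterDeriv (l ++ l') f = iterDeriv l (iterDeriv l' f) := List.foldr_append ..

lemma iterDeriv_replicate (k : ℕ) (v : E) (f : E → ℂ) :
    iterDeriv (List.replicate k v) f = (dirDeriv v)^[k] f := by
  induction k with
  | zero => rfl
  | succ k ih => rw [List.replicate_succ, iterDeriv_cons, ih, Function.iterate_succ_apply']

lemma differentiableOn_iterDeriv [FiniteDimensional ℂ E] {O : Set E} (hO : IsOpen O) {f : E → ℂ}
    (hf : DifferentiableOn ℂ f O) (l : List E) : DifferentiableOn ℂ (iterDeriv l f) O := by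
  induction l with
  | nil => exact hf
  | cons v l ih => exact differentiableOn_dirDeriv hO ih v

lemma iterDeriv_perm [FiniteDimensional ℂ E] {O : Set E} (hO : IsOpen O) {f : E → ℂ}
    (hf : DifferentiableOn ℂ f O) {l l' : List E} (h : l.Perm l') :
    EqOn (iterDeriv l f) (iterDeriv l' f) O := by
  induction h with
  | nil => exact fun _ _ => rfl
  | cons v _ ih => exact dirDeriv_congr hO ih v
  | swap u v l => exact dirDeriv_comm hO (differentiableOn_iterDeriv hO hf l) v u
  | trans _ _ ih ih' => exact ih.trans ih'

lemma dirDeriv_sum [FiniteDimensional ℂ E] {O : Set E} (hO : IsOpen O) {ι : Type*} (s : Finset ι)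
    (c : ι → ℂ) (g : ι → E → ℂ) (hg : ∀ i ∈ s, DifferentiableOn ℂ (g i) O) (v : E) :
    EqOn (dirDeriv v fun x => ∑ i ∈ s, c i * g i x) (fun x => ∑ i ∈ s, c i * dirDeriv v (g i) x)
      O := by
  intro x hx
  have h : HasFDerivAt (fun x => ∑ i ∈ s, c i * g i x) (∑ i ∈ s, c i • fderiv ℂ (g i) x) x :=
    HasFDerivAt.fun_sum fun i hi =>
      (((hg i hi).differentiableAt (hO.mem_nhds hx)).hasFDerivAt).const_mul (c i)
  simp [dirDeriv, h.fderiv]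

lemma iterDeriv_sum [FiniteDimensional ℂ E] {O : Set E} (hO : IsOpen O) {ι : Type*} (s : Finset ι)
    (c : ι → ℂ) (g : ι → E → ℂ) (hg : ∀ i ∈ s, DifferentiableOn ℂ (g i) O) (l : List E) :
    EqOn (iterDeriv l fun x => ∑ i ∈ s, c i * g i x) (fun x => ∑ i ∈ s, c i * iterDeriv l (g i) x)
      O := by
  induction l with
  | nil => exact fun _ _ => rfl
  | cons v l ih =>
    refine (dirDeriv_congr hO ih v).trans ?_
    exact dirDeriv_sum hO s c _ (fun i hi => differentiableOn_iterDeriv hO (hg i hi) l) v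

lemma dirDeriv_add_const (v : E) (f : E → ℂ) (c : ℂ) :
    dirDeriv v (fun x => f x + c) = dirDeriv v f := by
  ext x; simp [dirDeriv]

lemma iterDeriv_add_const (l : List E) (hl : l ≠ []) (f : E → ℂ) (c : ℂ) :
    iterDeriv l (fun x => f x + c) = iterDeriv l f := by
  induction l with
  | nil => exact absurd rfl hl
  | cons v l ih =>
    by_cases h : l = []
    · subst h; exact dirDeriv_add_const v f c
    · rw [iterDeriv_cons, ih h, iterDeriv_cons]

/-- Derivatives in the first group of variables of a function of two groups of variables. -/
lemma iterDeriv_prod {E' : Type*} [NormedAddCommGroup E'] [NormedSpace ℂ E']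
    [FiniteDimensional ℂ E] [FiniteDimensional ℂ E'] {O : Set (E × E')} (hO : IsOpen O)
    {g : E × E' → ℂ} (hg : DifferentiableOn ℂ g O) (l : List E) {x : E} {y : E'}
    (hxy : (x, y) ∈ O) :
    iterDeriv l (fun z => g (z, y)) x = iterDeriv (l.map fun v => (v, (0 : E'))) g (x, y) := by
  induction l generalizing x with
  | nil => rfl
  | cons v l ih =>
    have hO' : IsOpen {z | (z, y) ∈ O} := hO.preimage (by fun_prop)
    have h1 : EqOn (iterDeriv l fun z => g (z, y))
        (fun z => iterDeriv (l.map fun v => (v, (0 : E'))) g (z, y)) {z | (z, y) ∈ O} :=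
      fun z hz => ih hz
    rw [iterDeriv_cons, dirDeriv_congr hO' h1 v hxy, List.map_cons, iterDeriv_cons]
    have h2 : HasFDerivAt (fun z : E => (z, y)) (ContinuousLinearMap.inl ℂ E E') x :=
      hasFDerivAt_prodMk_left x y
    have h3 := ((differentiableOn_iterDeriv hO hg (l.map fun v => (v, (0 : E')))).differentiableAt
      (hO.mem_nhds hxy)).hasFDerivAt.comp x h2
    simp only [dirDeriv]
    have h4 := h3.fderiv
    simp only [Function.comp_def] at h4
    rw [h4]
    simp

end Holomorphic

/-! ### Mixed partial derivatives as iterated derivatives in coordinate directions. -/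

section MixedPartial

variable {n : ℕ}

/-- The unit vector of the coordinate `z_j`. -/
def zUnit (j : Fin n) : Cz n := (Pi.single j 1, 0)

/-- The unit vector of the coordinate `w`. -/
def wUnit : Cz n := (0, 1)

/-- The list of directions of the derivative `∂_z^β ∂_w^s`. -/
def directions (β : Fin n → ℕ) (s : ℕ) : List (Cz n) :=
  (List.finRange n).flatMap (fun j => List.replicate (β j) (zUnit j)) ++ List.replicate s wUnit

lemma mixedPartial_eq_iterDeriv (β : Fin n → ℕ) (s : ℕ) (f : Cz n → ℂ) :
    mixedPartial β s f = iterDeriv (directions β s) f := by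
  have h : ∀ (l : List (Fin n)) (g : Cz n → ℂ),
      l.foldr (fun j g => (dz j)^[β j] g) g =
        iterDeriv (l.flatMap fun j => List.replicate (β j) (zUnit j)) g := by
    intro l g
    induction l with
    | nil => rfl
    | cons j l ih =>
      rw [List.foldr_cons, ih, List.flatMap_cons, iterDeriv_append, iterDeriv_replicate]
      rfl
  rw [mixedPartial, h, directions, iterDeriv_append, iterDeriv_replicate]
  rfl

lemma differentiableOn_mixedPartial {O : Set (Cz n)} (hO : IsOpen O) {f : Cz n → ℂ}
    (hf : DifferentiableOn ℂ f O) (β : Fin n → ℕ) (s : ℕ) :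
    DifferentiableOn ℂ (mixedPartial β s f) O := by
  rw [mixedPartial_eq_iterDeriv]
  exact differentiableOn_iterDeriv hO hf _

/-- `mixedPartial` takes the derivatives in a fixed order, so a further derivative in z_j appears at
the front instead of in its own block. As derivatives commute, equality up to permutation is all
that is needed. -/
lemma perm_directions_add_single (β : Fin n → ℕ) (s : ℕ) (j : Fin n) :
    (zUnit j :: directions β s).Perm (directions (β + Pi.single j 1) s) := by
  classical
  rw [directions, directions, ← List.cons_append]
  refine List.Perm.append_right _ ?_
  have h : ∀ l : List (Fin n), l.Nodup →
      (l.flatMap fun i => List.replicate ((β + (Pi.single j 1 : Fin n → ℕ)) i) (zUnit i)).Perm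
        ((if j ∈ l then [zUnit j] else []) ++
          l.flatMap fun i => List.replicate (β i) (zUnit i)) := by
    intro l hl
    induction l with
    | nil => simp
    | cons a l ih =>
      have hl' := List.nodup_cons.1 hl
      simp only [List.flatMap_cons]
      by_cases haj : a = j
      · subst haj
        have := ih hl'.2
        simp only [hl'.1, if_false, List.nil_append] at this
        simp only [Pi.add_apply, Pi.single_eq_same, List.mem_cons, true_or, if_true]
        rw [List.replicate_succ]
        simpa using List.Perm.append_left _ this
      · have hja : ¬ j = a := fun h => haj h.symm
        have hβ : (β + (Pi.single j 1 : Fin n → ℕ)) a = β a := by simp [haj]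
        simp only [hβ, List.mem_cons, hja, false_or]
        refine (List.Perm.append_left _ (ih hl'.2)).trans ?_
        rw [← List.append_assoc, ← List.append_assoc]
        exact List.Perm.append_right _ List.perm_append_comm
  have := (h _ (List.nodup_finRange n)).symm
  simpa using this

lemma dirDeriv_zUnit_mixedPartial {O : Set (Cz n)} (hO : IsOpen O) {f : Cz n → ℂ}
    (hf : DifferentiableOn ℂ f O) (β : Fin n → ℕ) (s : ℕ) (j : Fin n) :
    EqOn (dirDeriv (zUnit j) (mixedPartial β s f)) (mixedPartial (β + Pi.single j 1) s f) O := by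
  rw [mixedPartial_eq_iterDeriv, mixedPartial_eq_iterDeriv, ← iterDeriv_cons]
  exact iterDeriv_perm hO hf (perm_directions_add_single β s j)

lemma dirDeriv_wUnit_mixedPartial {O : Set (Cz n)} (hO : IsOpen O) {f : Cz n → ℂ}
    (hf : DifferentiableOn ℂ f O) (β : Fin n → ℕ) (s : ℕ) :
    EqOn (dirDeriv wUnit (mixedPartial β s f)) (mixedPartial β (s + 1) f) O := by
  rw [mixedPartial_eq_iterDeriv, mixedPartial_eq_iterDeriv, ← iterDeriv_cons]
  refine iterDeriv_perm hO hf ?_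
  rw [directions, directions, List.replicate_succ]
  exact List.perm_middle.symm

@[simp] lemma mixedPartial_zero_zero (f : Cz n → ℂ) : mixedPartial 0 0 f = f := by
  rw [mixedPartial_eq_iterDeriv]
  have : directions (0 : Fin n → ℕ) 0 = [] := by simp [directions]
  rw [this, iterDeriv_nil]

lemma mixedPartial_zero_one (f : Cz n → ℂ) : mixedPartial 0 1 f = dirDeriv wUnit f := by
  rw [mixedPartial_eq_iterDeriv]
  have : directions (0 : Fin n → ℕ) 1 = [wUnit] := by simp [directions]
  rw [this, iterDeriv_cons, iterDeriv_nil]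

lemma mixedPartial_single {O : Set (Cz n)} (hO : IsOpen O) {f : Cz n → ℂ}
    (hf : DifferentiableOn ℂ f O) (j : Fin n) :
    EqOn (mixedPartial (Pi.single j 1) 0 f) (dirDeriv (zUnit j) f) O := by
  have := dirDeriv_zUnit_mixedPartial hO hf 0 0 j
  rw [mixedPartial_zero_zero, zero_add] at this
  exact this.symm

lemma directions_ne_nil {β : Fin n → ℕ} {s : ℕ} (h : 0 < order β + s) : directions β s ≠ [] := by
  intro h0
  have hlen : (directions β s).length = order β + s := by
    simp [directions, order, List.length_flatMap, ← List.ofFn_eq_map, List.sum_ofFn]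
  rw [h0] at hlen
  simp at hlen
  omega

lemma mixedPartial_sum_add_const {O : Set (Cz n)} (hO : IsOpen O) {ι : Type*} (t : Finset ι)
    (c : ι → ℂ) (g : ι → Cz n → ℂ) (hg : ∀ i ∈ t, DifferentiableOn ℂ (g i) O) (b : ℂ)
    {β : Fin n → ℕ} {s : ℕ} (h : 0 < order β + s) :
    EqOn (mixedPartial β s fun x => ∑ i ∈ t, c i * g i x + b)
      (fun x => ∑ i ∈ t, c i * mixedPartial β s (g i) x) O := by
  simp only [mixedPartial_eq_iterDeriv]
  rw [iterDeriv_add_const _ (directions_ne_nil h)]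
  exact iterDeriv_sum hO t c g hg _

/-- Derivatives in Z with y frozen are derivatives of g on the product in the directions (v, 0),
hence jointly holomorphic. Applied to ρ, this makes its derivatives at Z = 0 holomorphic in χ. -/
lemma differentiableOn_mixedPartial_param {O : Set (Cz n × Cz n)} (hO : IsOpen O)
    {g : Cz n × Cz n → ℂ} (hg : DifferentiableOn ℂ g O) (β : Fin n → ℕ) (s : ℕ) (x : Cz n) :
    DifferentiableOn ℂ (fun y => mixedPartial β s (fun Z => g (Z, y)) x) {y | (x, y) ∈ O} := by
  have h : DifferentiableOn ℂ
      (fun y => iterDeriv ((directions β s).map fun v => (v, (0 : Cz n))) g (x, y))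
      {y | (x, y) ∈ O} :=
    (differentiableOn_iterDeriv hO hg _).comp (by fun_prop) fun y hy => hy
  refine h.congr fun y hy => ?_
  rw [mixedPartial_eq_iterDeriv]
  exact iterDeriv_prod hO hg _ hy

end MixedPartial

/-! ### The implicit function theorem, tangency, and the identity theorem on a hypersurface. -/

section ImplicitFunction

variable {E : Type*} [NormedAddCommGroup E] [NormedSpace ℂ E]

/-- Holomorphic implicit function theorem for one equation, solved in the direction `v`. -/
lemma exists_implicit [FiniteDimensional ℂ E] {O : Set E} (hO : IsOpen O) {f : E → ℂ} (hf : DifferentiableOn ℂ f O)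
    {p v : E} (hp : p ∈ O) (hfp : f p = 0) (hv : fderiv ℂ f p v ≠ 0) :
    ∃ σ : E → ℂ, ∃ δ > 0, DifferentiableOn ℂ σ (ball p δ) ∧ σ p = 0 ∧
      (∀ Z ∈ ball p δ, f (Z + σ Z • v) = 0) ∧
      ∀ Z ∈ ball p δ, ∀ s : ℂ, ‖s‖ < δ → f (Z + s • v) = 0 → s = σ Z := by
  have : CompleteSpace E := FiniteDimensional.complete ℂ E
  -- An extra variable for the displacement along v avoids choosing a complement of v in E.
  let g : E × ℂ → ℂ := fun q => f (q.1 + q.2 • v)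
  have hg0 : g (p, 0) = 0 := by simp [g, hfp]
  have hfc : ContDiffAt ℂ ((1 : ℕ) : WithTop ℕ∞) f p := contDiffAt_of_differentiableOn hO hf hp 1
  have hg : ContDiffAt ℂ ((1 : ℕ) : WithTop ℕ∞) g (p, 0) := by
    refine ContDiffAt.comp (p, (0 : ℂ)) (g := f) (f := fun q : E × ℂ => q.1 + q.2 • v) ?_ ?_
    · simpa using hfc
    · fun_prop
  have hgd : HasFDerivAt g ((fderiv ℂ f p).comp (ContinuousLinearMap.fst ℂ E ℂ +
      (ContinuousLinearMap.snd ℂ E ℂ).smulRight v)) (p, 0) := by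
    have h1 : HasFDerivAt f (fderiv ℂ f p) ((p, (0 : ℂ)).1 + (p, (0 : ℂ)).2 • v) := by
      simpa using (hf.differentiableAt (hO.mem_nhds hp)).hasFDerivAt
    refine h1.comp (p, (0 : ℂ)) (f := fun q : E × ℂ => q.1 + q.2 • v) ?_
    exact (hasFDerivAt_fst).add ((ContinuousLinearMap.snd ℂ E ℂ).hasFDerivAt.smul_const v)
  have hinv : (fderiv ℂ g (p, 0) ∘L .inr ℂ E ℂ).IsInvertible := by
    refine ⟨ContinuousLinearEquiv.unitsEquivAut ℂ (Units.mk0 _ hv), ?_⟩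
    ext
    simp [hgd.fderiv]
  have h1 : (((1 : ℕ) : WithTop ℕ∞)) ≠ 0 := by simp
  set σ := hg.implicitFunction h1 hinv with hσ
  have hσ0 : σ p = 0 := hg.implicitFunction_apply_self h1 hinv
  have e1 : ∀ᶠ Z in 𝓝 p, f (Z + σ Z • v) = 0 := by
    have := hg.eventually_apply_implicitFunction h1 hinv
    rw [hg0] at this
    exact this
  have e2 : ∀ᶠ q : E × ℂ in 𝓝 (p, 0), g q = 0 ↔ σ q.1 = q.2 := by
    have := hg.eventually_apply_eq_iff_implicitFunction h1 hinv
    rw [hg0] at this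
    exact this
  have e3 : ∀ᶠ Z in 𝓝 p, DifferentiableAt ℂ σ Z := by
    have := (hg.contDiffAt_implicitFunction h1 hinv).eventually (by simp)
    filter_upwards [this] with Z hZ
    exact hZ.differentiableAt h1
  obtain ⟨δ₁, hδ₁, h13⟩ := Metric.eventually_nhds_iff_ball.1 (e1.and e3)
  obtain ⟨δ₂, hδ₂, h2⟩ := Metric.eventually_nhds_iff_ball.1 e2
  refine ⟨σ, min δ₁ δ₂, lt_min hδ₁ hδ₂, ?_, hσ0, ?_, ?_⟩
  · exact fun Z hZ => (h13 Z (ball_subset_ball (min_le_left _ _) hZ)).2.differentiableWithinAt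
  · exact fun Z hZ => (h13 Z (ball_subset_ball (min_le_left _ _) hZ)).1
  · intro Z hZ s hs hfs
    refine ((h2 (Z, s) ?_).1 hfs).symm
    rw [← ball_prod_same]
    exact ⟨ball_subset_ball (min_le_right _ _) hZ, by
      simpa using hs.trans_le (min_le_right _ _)⟩

/-- A function vanishing on a smooth hypersurface has a differential proportional to that of the
defining function. -/
lemma fderiv_mul_sub_eq_zero [FiniteDimensional ℂ E] {O : Set E} (hO : IsOpen O) {f F : E → ℂ}
    (hf : DifferentiableOn ℂ f O) (hF : DifferentiableOn ℂ F O)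
    (hfF : ∀ Z ∈ O, f Z = 0 → F Z = 0) {p u v : E} (hp : p ∈ O) (hfp : f p = 0)
    (hv : fderiv ℂ f p v ≠ 0) :
    fderiv ℂ f p v * fderiv ℂ F p u - fderiv ℂ f p u * fderiv ℂ F p v = 0 := by
  obtain ⟨σ, δ, hδ, hσ, hσp, hσf, -⟩ := exists_implicit hO hf hp hfp hv
  set x : E := fderiv ℂ f p v • u - fderiv ℂ f p u • v with hx
  have hfx : fderiv ℂ f p x = 0 := by simp [hx]; ring
  have hline : HasDerivAt (fun t : ℂ => p + t • x) x 0 := by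
    simpa using ((hasDerivAt_id (0 : ℂ)).smul_const x).const_add p
  have hσd : HasFDerivAt σ (fderiv ℂ σ p) (p + (0 : ℂ) • x) := by
    simpa using (hσ.differentiableAt (ball_mem_nhds p hδ)).hasFDerivAt
  have hσl := hσd.comp_hasDerivAt (0 : ℂ) hline
  have hγ : HasDerivAt (fun t : ℂ => p + t • x + σ (p + t • x) • v)
      (x + fderiv ℂ σ p x • v) 0 := hline.add (hσl.smul_const v)
  have hγ0 : (fun t : ℂ => p + t • x + σ (p + t • x) • v) 0 = p := by simp [hσp]
  have hev : ∀ᶠ t in 𝓝 (0 : ℂ), p + t • x + σ (p + t • x) • v ∈ O ∧ p + t • x ∈ ball p δ := by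
    refine Eventually.and ?_ ?_
    · exact hγ.continuousAt.eventually_mem (by simpa [hσp] using hO.mem_nhds hp)
    · exact hline.continuousAt.eventually_mem (by simpa using ball_mem_nhds p hδ)
  have hcomp : ∀ g : E → ℂ, DifferentiableOn ℂ g O → (∀ Z ∈ O, f Z = 0 → g Z = 0) →
      fderiv ℂ g p (x + fderiv ℂ σ p x • v) = 0 := by
    intro g hg hfg
    have h1 : HasFDerivAt g (fderiv ℂ g p) ((fun t : ℂ => p + t • x + σ (p + t • x) • v) 0) := by
      rw [hγ0]; exact (hg.differentiableAt (hO.mem_nhds hp)).hasFDerivAt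
    have h2 := h1.comp_hasDerivAt (0 : ℂ) hγ
    have h3 : (g ∘ fun t : ℂ => p + t • x + σ (p + t • x) • v) =ᶠ[𝓝 0] fun _ => 0 := by
      filter_upwards [hev] with t ht
      exact hfg _ ht.1 (hσf _ ht.2)
    have h4 := h3.hasDerivAt_iff.1 h2
    exact h4.unique (hasDerivAt_const _ _)
  have h1 := hcomp f hf fun _ _ h => h
  have h2 : fderiv ℂ σ p x = 0 := by
    rw [map_add, hfx, map_smul, zero_add, smul_eq_mul] at h1
    exact (mul_eq_zero.1 h1).resolve_right hv
  have h3 := hcomp F hF hfF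
  rw [h2, zero_smul, add_zero, hx, map_sub, map_smul, map_smul] at h3
  exact h3

/-- A holomorphic function on a convex open set that vanishes near a point vanishes identically. -/
lemma eqOn_zero_of_convex {O : Set E} (hO : IsOpen O) (hc : Convex ℝ O) {g : E → ℂ}
    (hg : DifferentiableOn ℂ g O) {q : E} (hq : q ∈ O) (h0 : ∀ᶠ Z in 𝓝 q, g Z = 0) :
    ∀ Z ∈ O, g Z = 0 := by
  intro Z hZ
  let γ : ℂ → E := fun t => q + t • (Z - q)
  have hγ : Differentiable ℂ γ := by fun_prop
  have hΩ : IsOpen (γ ⁻¹' O) := hO.preimage hγ.continuous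
  have hΩc : Convex ℝ (γ ⁻¹' O) := by
    intro s hs t ht a b ha hb hab
    have : γ (a • s + b • t) = a • γ s + b • γ t := by
      simp only [γ, smul_add, add_smul, smul_assoc]
      have : q = a • q + b • q := by rw [← add_smul, hab, one_smul]
      nth_rewrite 1 [this]
      abel
    rw [mem_preimage, this]
    exact hc hs ht ha hb hab
  have han : AnalyticOnNhd ℂ (g ∘ γ) (γ ⁻¹' O) :=
    (hg.comp hγ.differentiableOn fun _ h => h).analyticOnNhd hΩ
  have hγ0 : γ 0 = q := by simp [γ]
  have hev : (g ∘ γ) =ᶠ[𝓝 0] 0 := by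
    have := hγ.continuous.continuousAt (x := (0 : ℂ))
    rw [ContinuousAt, hγ0] at this
    exact this.eventually h0
  have := han.eqOn_zero_of_preconnected_of_eventuallyEq_zero hΩc.isPreconnected
    (by simpa [hγ0] using hq) hev (x := 1) (by simpa [γ] using hZ)
  simpa [γ] using this

/-- Identity theorem on a hypersurface whose regular points form a connected dense subset. -/
lemma eqOn_zero_of_irreducible [FiniteDimensional ℂ E] {U : Set E} (hU : IsOpen U) {f g : E → ℂ}
    (hf : DifferentiableOn ℂ f U) (hg : DifferentiableOn ℂ g U)
    (hconn : IsPreconnected {Z | (Z ∈ U ∧ f Z = 0) ∧ fderiv ℂ f Z ≠ 0})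
    (hdense : {Z | Z ∈ U ∧ f Z = 0} ⊆ closure {Z | (Z ∈ U ∧ f Z = 0) ∧ fderiv ℂ f Z ≠ 0})
    {p₀ : E} (hp₀ : p₀ ∈ {Z | (Z ∈ U ∧ f Z = 0) ∧ fderiv ℂ f Z ≠ 0})
    (h0 : ∀ᶠ Z in 𝓝 p₀, Z ∈ U → f Z = 0 → g Z = 0) :
    ∀ Z ∈ U, f Z = 0 → g Z = 0 := by
  set Reg := {Z | (Z ∈ U ∧ f Z = 0) ∧ fderiv ℂ f Z ≠ 0} with hReg
  -- A is open by definition. The work is to show that it is also relatively closed in the regular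
  -- part.
  set A := {p : E | ∀ᶠ Z in 𝓝 p, Z ∈ U → f Z = 0 → g Z = 0} with hA
  have hAopen : IsOpen A := by
    rw [isOpen_iff_mem_nhds]
    exact fun p hp => eventually_eventually_nhds.2 hp
  have hloc : ∀ p ∈ Reg, ∃ δ > 0, (∃ q ∈ A ∩ ball p δ, q ∈ U ∧ f q = 0) →
      ∀ Z ∈ ball p δ, Z ∈ U → f Z = 0 → g Z = 0 := by
    rintro p ⟨⟨hpU, hfp⟩, hdf⟩
    obtain ⟨v, hv⟩ : ∃ v, fderiv ℂ f p v ≠ 0 := by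
      by_contra! h
      exact hdf (ContinuousLinearMap.ext h)
    obtain ⟨σ, δ, hδ, hσ, hσp, hσf, hσu⟩ := exists_implicit hU hf hpU hfp hv
    -- A holomorphic retraction of a small ball into {f = 0}, fixing the zeros of f in the ball.
    -- Thus g ∘ r is holomorphic on a convex set, and its vanishing near one point forces g = 0 on
    -- the zeros of f in the ball.
    let r : E → E := fun Z => Z + σ Z • v
    have hrp : r p = p := by simp [r, hσp]
    have hrc : ContinuousAt r p :=
      continuousAt_id.add ((hσ.differentiableAt (ball_mem_nhds p hδ)).continuousAt.smul
        continuousAt_const)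
    obtain ⟨ε, hε, hεr⟩ := Metric.eventually_nhds_iff_ball.1
      (hrc.eventually_mem (by rw [hrp]; exact hU.mem_nhds hpU))
    refine ⟨min δ ε, lt_min hδ hε, ?_⟩
    rintro ⟨q, ⟨hqA, hqb⟩, hqU, hfq⟩ Z hZ hZU hfZ
    have hsub : ball p (min δ ε) ⊆ ball p δ := ball_subset_ball (min_le_left _ _)
    have hrd : DifferentiableOn ℂ r (ball p (min δ ε)) :=
      differentiableOn_id.add ((hσ.mono hsub).smul_const v)
    have hmaps : MapsTo r (ball p (min δ ε)) U := fun Z hZ =>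
      hεr Z (ball_subset_ball (min_le_right _ _) hZ)
    have hfix : ∀ Z ∈ ball p (min δ ε), f Z = 0 → r Z = Z := by
      intro Z hZ hfZ
      have := hσu Z (hsub hZ) 0 (by simpa using hδ) (by simpa using hfZ)
      simp [r, ← this]
    have := eqOn_zero_of_convex isOpen_ball (convex_ball p (min δ ε)) (hg.comp hrd hmaps) hqb ?_ Z hZ
    · simpa [hfix Z hZ hfZ] using this
    · have hc : ContinuousAt r q := (hrd.differentiableAt (isOpen_ball.mem_nhds hqb)).continuousAt
      rw [ContinuousAt, hfix q hqb hfq] at hc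
      filter_upwards [hc.eventually hqA, isOpen_ball.mem_nhds hqb] with Z h1 h2
      exact h1 (hmaps h2) (hσf Z (hsub h2))
  choose! δ hδ hδA using hloc
  have hRegA : Reg ⊆ A := by
    by_contra hne
    obtain ⟨p, hpR, hpA⟩ := not_subset.1 hne
    -- If A missed a regular point, connectedness would give a regular point of A in the good ball
    -- around some regular point outside A; local propagation then puts the centre of that ball into
    -- A.
    obtain ⟨q, hqR, hqA, hqv⟩ := hconn A (⋃ p ∈ Reg \ A, ball p (δ p)) hAopen
      (isOpen_biUnion fun _ _ => isOpen_ball)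
      (fun x hx => by
        by_cases hxA : x ∈ A
        · exact Or.inl hxA
        · exact Or.inr (mem_biUnion (show x ∈ Reg \ A from ⟨hx, hxA⟩) (mem_ball_self (hδ x hx))))
      ⟨p₀, hp₀, h0⟩ ⟨p, hpR, mem_biUnion (show p ∈ Reg \ A from ⟨hpR, hpA⟩)
        (mem_ball_self (hδ p hpR))⟩
    obtain ⟨p', hp', hqp'⟩ := mem_iUnion₂.1 hqv
    refine hp'.2 ?_
    filter_upwards [ball_mem_nhds p' (hδ p' hp'.1)] with Z hZ
    exact hδA p' hp'.1 ⟨q, ⟨hqA, hqp'⟩, hqR.1⟩ Z hZ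
  intro Z hZU hfZ
  by_contra hgZ
  have hev : ∀ᶠ Y in 𝓝 Z, g Y ≠ 0 :=
    (hg.differentiableAt (hU.mem_nhds hZU)).continuousAt.eventually_ne hgZ
  obtain ⟨Y, hY, hYR⟩ := mem_closure_iff_nhds.1 (hdense ⟨hZU, hfZ⟩) _ hev
  exact hY ((hRegA hYR).self_of_nhds hYR.1.1 hYR.1.2)

end ImplicitFunction

/-! ### Passing from the real hypersurface to its complexification. -/

section Complexification

variable {n : ℕ}

lemma star_mem_ball_iff {r : ℝ} {Z : Cz n} : star Z ∈ ball (0 : Cz n) r ↔ Z ∈ ball (0 : Cz n) r := by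
  rw [mem_ball_zero_iff, mem_ball_zero_iff, norm_star]

/-- The set of the points `(Z, Z̄)` is a uniqueness set for holomorphic functions. -/
lemma eq_zero_of_eq_zero_on_conj {r : ℝ} {G : Cz n × Cz n → ℂ}
    (hG : DifferentiableOn ℂ G (ball 0 r ×ˢ ball 0 r))
    (h : ∀ Z ∈ ball (0 : Cz n) r, G (Z, star Z) = 0) :
    ∀ Z ∈ ball (0 : Cz n) r, ∀ χ ∈ ball (0 : Cz n) r, G (Z, χ) = 0 := by
  intro Z hZ χ hχ
  -- With Z = a + i b and χ = ā + i b̄, the complex line γ below reaches (Z, χ) at t = i, while for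
  -- real t it runs through points (W, W̄). The one-variable identity theorem then applies to G ∘ γ.
  set a : Cz n := (2⁻¹ : ℂ) • (Z + star χ) with ha
  set b : Cz n := (2⁻¹ * -Complex.I : ℂ) • (Z - star χ) with hb
  have hsa : star a = (2⁻¹ : ℂ) • (star Z + χ) := by simp [ha, star_smul]
  have hsb : star b = (2⁻¹ * Complex.I : ℂ) • (star Z - χ) := by simp [hb, star_smul]
  let γ : ℂ → Cz n × Cz n := fun t => (a + t • b, star a + t • star b)
  have hγ : Differentiable ℂ γ := by fun_prop
  have hI : γ Complex.I = (Z, χ) := by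
    have h1 : Complex.I * (2⁻¹ * -Complex.I) = 2⁻¹ := by
      linear_combination (-2⁻¹ : ℂ) * Complex.I_mul_I
    have h2 : Complex.I * (2⁻¹ * Complex.I) = -2⁻¹ := by
      linear_combination (2⁻¹ : ℂ) * Complex.I_mul_I
    have h3 : (2⁻¹ : ℂ) + 2⁻¹ = 1 := by norm_num
    refine Prod.ext ?_ ?_
    · simp only [γ, hb, ha, smul_smul, h1]
      rw [← smul_add, show Z + star χ + (Z - star χ) = Z + Z by abel, smul_add, ← add_smul, h3,
        one_smul]
    · simp only [γ, hsb, hsa, smul_smul, h2]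
      rw [neg_smul, ← sub_eq_add_neg, ← smul_sub,
        show star Z + χ - (star Z - χ) = χ + χ by abel, smul_add, ← add_smul, h3, one_smul]
  have hreal : ∀ t : ℝ, (γ t).2 = star (γ t).1 := by
    intro t
    simp [γ, star_add, star_smul]
  set Ω := γ ⁻¹' (ball 0 r ×ˢ ball 0 r) with hΩdef
  have hΩ : IsOpen Ω := (isOpen_ball.prod isOpen_ball).preimage hγ.continuous
  have hΩc : Convex ℝ Ω := by
    intro s hs t ht x y hx hy hxy
    have : γ (x • s + y • t) = x • γ s + y • γ t := by
      have h1 : ∀ c : Cz n, c = x • c + y • c := fun c => by rw [← add_smul, hxy, one_smul]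
      refine Prod.ext ?_ ?_
      · simp only [γ, smul_add, add_smul, smul_assoc, Prod.fst_add, Prod.smul_fst]
        nth_rewrite 1 [h1 a]
        abel
      · simp only [γ, smul_add, add_smul, smul_assoc, Prod.snd_add, Prod.smul_snd]
        nth_rewrite 1 [h1 (star a)]
        abel
    rw [hΩdef, mem_preimage, this]
    exact ((convex_ball _ _).prod (convex_ball _ _)) hs ht hx hy hxy
  have han : AnalyticOnNhd ℂ (G ∘ γ) Ω := (hG.comp hγ.differentiableOn fun _ h => h).analyticOnNhd hΩ
  have hab : a ∈ ball (0 : Cz n) r := by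
    have := (convex_ball (0 : Cz n) r) hZ (star_mem_ball_iff.2 hχ)
      (by norm_num : (0 : ℝ) ≤ 2⁻¹) (by norm_num : (0 : ℝ) ≤ 2⁻¹) (by norm_num)
    convert! this using 1
    rw [← smul_add, ha]
    ext <;> simp
  have h0 : (0 : ℂ) ∈ Ω := by
    simp only [hΩdef, mem_preimage, γ, zero_smul, add_zero, mem_prod]
    exact ⟨hab, star_mem_ball_iff.2 hab⟩
  have hfreq : ∃ᶠ t in 𝓝[≠] (0 : ℂ), (G ∘ γ) t = 0 := by
    have hT : Tendsto (fun t : ℝ => (t : ℂ)) (𝓝[≠] 0) (𝓝[≠] 0) := by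
      refine tendsto_nhdsWithin_iff.2 ⟨?_, ?_⟩
      · exact (Complex.continuous_ofReal.tendsto' 0 0 (by simp)).mono_left nhdsWithin_le_nhds
      · filter_upwards [self_mem_nhdsWithin] with t ht
        simpa using ht
    refine hT.frequently (Eventually.frequently ?_)
    have hmem : ∀ᶠ t : ℂ in 𝓝[≠] 0, t ∈ Ω := nhdsWithin_le_nhds (hΩ.mem_nhds h0)
    filter_upwards [hT.eventually hmem] with t ht
    have : γ t = ((γ t).1, star (γ t).1) := Prod.ext rfl (hreal t)
    rw [Function.comp_apply, this]
    exact h _ ht.1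
  have := han.eqOn_zero_of_preconnected_of_frequently_eq_zero hΩc.isPreconnected h0 hfreq
    (x := Complex.I) (by rw [hΩdef, mem_preimage, hI]; exact ⟨hZ, hχ⟩)
  simpa [hI] using this

/-- The reality condition of a complexified real-valued function. -/
lemma star_eq_of_real_on_conj {r : ℝ} {g : Cz n × Cz n → ℂ}
    (hg : DifferentiableOn ℂ g (ball 0 r ×ˢ ball 0 r))
    (h : ∀ Z ∈ ball (0 : Cz n) r, (g (Z, star Z)).im = 0) :
    ∀ Z ∈ ball (0 : Cz n) r, ∀ χ ∈ ball (0 : Cz n) r, star (g (star χ, star Z)) = g (Z, χ) := by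
  -- Conjugating both the arguments and the value preserves holomorphy, and on χ = Z̄ the difference
  -- vanishes because g is real there.
  have hd : DifferentiableOn ℂ (fun p : Cz n × Cz n => g p - star (g (star p.2, star p.1)))
      (ball 0 r ×ˢ ball 0 r) := by
    refine hg.sub fun p hp => DifferentiableAt.differentiableWithinAt ?_
    have h1 : DifferentiableAt ℂ (fun p : Cz n × Cz n => g (p.2, p.1)) (star p) := by
      refine DifferentiableAt.comp (g := g) (star p) ?_ (by fun_prop)
      refine hg.differentiableAt ((isOpen_ball.prod isOpen_ball).mem_nhds ?_)
      exact ⟨star_mem_ball_iff.2 hp.2, star_mem_ball_iff.2 hp.1⟩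
    have h2 := h1.star_star
    rw [star_star] at h2
    exact h2
  intro Z hZ χ hχ
  have := eq_zero_of_eq_zero_on_conj hd (fun W hW => ?_) Z hZ χ hχ
  · exact (sub_eq_zero.1 this).symm
  · simp only [star_star]
    rw [sub_eq_zero, eq_comm]
    exact Complex.conj_eq_iff_im.2 (h W hW)

/-- If a holomorphic `Q` vanishes on the real hypersurface `ρ(Z, Z̄) = 0`, it vanishes on its
complexification `ρ(Z, χ) = 0`. -/
lemma exists_eq_zero_of_eq_zero_on_hypersurface {r : ℝ} (hr : 0 < r) {g Q : Cz n × Cz n → ℂ}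
    (hg : DifferentiableOn ℂ g (ball 0 r ×ˢ ball 0 r))
    (hQ : DifferentiableOn ℂ Q (ball 0 r ×ˢ ball 0 r))
    (hreal : ∀ Z ∈ ball (0 : Cz n) r, (g (Z, star Z)).im = 0)
    (hg0 : g (0, 0) = 0) (hgw : fderiv ℂ g (0, 0) (wUnit, 0) ≠ 0)
    (hgQ : ∀ Z ∈ ball (0 : Cz n) r, g (Z, star Z) = 0 → Q (Z, star Z) = 0) :
    ∃ δ > 0, ∀ Z ∈ ball (0 : Cz n) δ, ∀ χ ∈ ball (0 : Cz n) δ, g (Z, χ) = 0 → Q (Z, χ) = 0 := by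
  have hsym := star_eq_of_real_on_conj hg hreal
  -- The equation must be solved in a direction tangent to the set {χ = Z̄}. Such a direction exists
  -- because (∂_w, 0) is a complex combination of (u, ū) for u = ∂_w and u = i ∂_w.
  obtain ⟨u, hu⟩ : ∃ u : Cz n, fderiv ℂ g (0, 0) (u, star u) ≠ 0 := by
    by_contra! hcon
    apply hgw
    have h1 := hcon wUnit
    have h2 := hcon (Complex.I • wUnit)
    have h3 : ((wUnit : Cz n), (0 : Cz n)) = (2⁻¹ : ℂ) • ((wUnit, star wUnit) : Cz n × Cz n) +
        (2⁻¹ * -Complex.I : ℂ) • (Complex.I • wUnit, star (Complex.I • wUnit)) := by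
      have hI : (2⁻¹ * -Complex.I) * Complex.I = (2⁻¹ : ℂ) := by
        linear_combination (-2⁻¹ : ℂ) * Complex.I_mul_I
      refine Prod.ext ?_ ?_
      · simp only [Prod.fst_add, Prod.smul_fst, smul_smul, hI, ← add_smul]
        norm_num
      · simp only [Prod.snd_add, Prod.smul_snd, star_smul, Complex.star_def, Complex.conj_I,
          neg_smul, mul_neg]
        simp [smul_smul, mul_assoc]
    rw [h3, map_add, map_smul, map_smul, h1, h2]
    simp
  have hO : IsOpen (ball (0 : Cz n) r ×ˢ ball (0 : Cz n) r) := isOpen_ball.prod isOpen_ball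
  obtain ⟨σ, δ, hδ, hσ, hσ0, hσz, hσu⟩ := exists_implicit hO hg
    (p := (0, 0)) ⟨mem_ball_self hr, mem_ball_self hr⟩ hg0 hu
  set v : Cz n × Cz n := (u, star u) with hv
  have hσc : ContinuousAt σ (0, 0) := (hσ.differentiableAt (ball_mem_nhds _ hδ)).continuousAt
  have hev : ∀ᶠ p in 𝓝 ((0 : Cz n), (0 : Cz n)), p + σ p • v ∈ ball (0 : Cz n) r ×ˢ ball (0 : Cz n) r
      ∧ ‖σ p‖ < δ := by
    refine Eventually.and ?_ ?_
    · have : ContinuousAt (fun p => p + σ p • v) (0, 0) :=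
        continuousAt_id.add (hσc.smul continuousAt_const)
      refine this.eventually_mem (hO.mem_nhds ?_)
      simp [hσ0, hr]
    · exact hσc.norm.eventually_lt continuousAt_const (by simpa [hσ0] using hδ)
  obtain ⟨ε, hε, hεp⟩ := Metric.eventually_nhds_iff_ball.1 hev
  rw [← ball_prod_same] at hεp hσ hσz hσu
  have hsub : ball (0 : Cz n) (min ε δ) ×ˢ ball (0 : Cz n) (min ε δ) ⊆ ball 0 δ ×ˢ ball 0 δ :=
    prod_mono (ball_subset_ball (min_le_right _ _)) (ball_subset_ball (min_le_right _ _))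
  have hsub' : ball (0 : Cz n) (min ε δ) ×ˢ ball (0 : Cz n) (min ε δ) ⊆ ball 0 ε ×ˢ ball 0 ε :=
    prod_mono (ball_subset_ball (min_le_left _ _)) (ball_subset_ball (min_le_left _ _))
  have hGd : DifferentiableOn ℂ (fun p => Q (p + σ p • v))
      (ball (0 : Cz n) (min ε δ) ×ˢ ball (0 : Cz n) (min ε δ)) := by
    refine hQ.comp (f := fun p => p + σ p • v) (differentiableOn_id.add
      ((hσ.mono hsub).smul_const v)) fun p hp => (hεp p (hsub' hp)).1
  have hG := eq_zero_of_eq_zero_on_conj hGd fun Z hZ => ?_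
  · refine ⟨min ε δ, lt_min hε hδ, fun Z hZ χ hχ h => ?_⟩
    have h0 := hσu (Z, χ) (hsub ⟨hZ, hχ⟩) 0 (by simpa using hδ) (by simpa using h)
    have := hG Z hZ χ hχ
    rwa [← h0, zero_smul, add_zero] at this
  · set p : Cz n × Cz n := (Z, star Z) with hp
    have hpm : p ∈ ball (0 : Cz n) (min ε δ) ×ˢ ball (0 : Cz n) (min ε δ) :=
      ⟨hZ, star_mem_ball_iff.2 hZ⟩
    have hmem := hεp p (hsub' hpm)
    have hz := hσz p (hsub hpm)
    -- By the reality condition the conjugate of σ(p) solves the same equation, so uniqueness of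
    -- small solutions makes σ real on {χ = Z̄}. The corrected point therefore comes from M, where Q
    -- vanishes.
    have hs : star (σ p) = σ p := by
      refine hσu p (hsub hpm) _ (by rw [norm_star]; exact hmem.2) ?_
      have := hsym _ hmem.1.1 _ hmem.1.2
      rw [Prod.mk.eta, hz, star_eq_zero] at this
      convert! this using 2
      refine Prod.ext ?_ ?_
      · simp [hp, hv, star_smul]
      · simp [hp, hv, star_smul]
    have hdiag : p + σ p • v = ((p + σ p • v).1, star (p + σ p • v).1) := by
      refine Prod.ext rfl ?_
      simp only [Prod.snd_add, Prod.smul_snd, Prod.fst_add, Prod.smul_fst, star_add, star_smul, hs]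
      simp [hp, hv]
    rw [hdiag]
    refine hgQ _ hmem.1.1 ?_
    rw [← hdiag, hz]

end Complexification

/-! ### Weight filtrations on polynomials and their behaviour under derivations. -/

section WeightFiltration

variable {σ : Type*}

/-- The polynomials all of whose monomials have weight at most `a`. -/
def weightLE (w : σ → ℕ) (a : ℕ) : Submodule ℂ (MvPolynomial σ ℂ) where
  carrier := {P | ∀ m ∈ P.support, Finsupp.weight w m ≤ a}
  zero_mem' := by simp
  add_mem' := by
    classical
    intro P Q hP hQ m hm
    rcases Finset.mem_union.1 (MvPolynomial.support_add hm) with h | h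
    exacts [hP m h, hQ m h]
  smul_mem' := fun _ _ hP m hm => hP m (MvPolynomial.support_smul hm)

lemma weightLE_mono {w : σ → ℕ} {a b : ℕ} (h : a ≤ b) : weightLE w a ≤ weightLE w b :=
  fun _ hP m hm => (hP m hm).trans h

lemma weight_mono {w w' : σ → ℕ} (h : ∀ v, w' v ≤ w v) (m : σ →₀ ℕ) :
    Finsupp.weight w' m ≤ Finsupp.weight w m := by
  simp only [Finsupp.weight_apply, Finsupp.sum, smul_eq_mul]
  exact Finset.sum_le_sum fun i _ => Nat.mul_le_mul_left _ (h i)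

lemma weightLE_anti {w w' : σ → ℕ} (h : ∀ v, w' v ≤ w v) (a : ℕ) :
    weightLE w a ≤ weightLE w' a :=
  fun _ hP m hm => (weight_mono h m).trans (hP m hm)

lemma monomial_mem_weightLE {w : σ → ℕ} {a : ℕ} {m : σ →₀ ℕ} (h : Finsupp.weight w m ≤ a) (r : ℂ) :
    MvPolynomial.monomial m r ∈ weightLE w a := by
  intro m' hm'
  rw [Finset.mem_singleton.1 (MvPolynomial.support_monomial_subset hm')]
  exact h

lemma C_mem_weightLE (w : σ → ℕ) (r : ℂ) : MvPolynomial.C r ∈ weightLE w 0 :=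
  monomial_mem_weightLE (by simp) r

lemma X_mem_weightLE {w : σ → ℕ} {a : ℕ} {v : σ} (h : w v ≤ a) :
    (MvPolynomial.X v : MvPolynomial σ ℂ) ∈ weightLE w a :=
  monomial_mem_weightLE (by simpa [Finsupp.weight_single] using h) 1

lemma mul_mem_weightLE {w : σ → ℕ} {a b : ℕ} {P Q : MvPolynomial σ ℂ} (hP : P ∈ weightLE w a)
    (hQ : Q ∈ weightLE w b) : P * Q ∈ weightLE w (a + b) := by
  classical
  intro m hm
  obtain ⟨x, hx, y, hy, rfl⟩ := Finset.mem_add.1 (MvPolynomial.support_mul P Q hm)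
  rw [map_add]
  exact add_le_add (hP x hx) (hQ y hy)

/-- The derivation replacing the variable `X v` by `X (g v)`. -/
noncomputable def shiftDerivation (g : σ → σ) :
    Derivation ℂ (MvPolynomial σ ℂ) (MvPolynomial σ ℂ) :=
  MvPolynomial.mkDerivation ℂ fun v => MvPolynomial.X (g v)

lemma shiftDerivation_X (g : σ → σ) (v : σ) :
    shiftDerivation g (MvPolynomial.X v) = MvPolynomial.X (g v) :=
  MvPolynomial.mkDerivation_X ..

/-- A derivation replaces one factor of a monomial at a time, so the weight grows by at most c. Two
weights are allowed because the order bound k, itself encoded as a weight, rises to k + 1 under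
differentiation. -/
lemma shiftDerivation_mem_weightLE {w w' : σ → ℕ} {g : σ → σ} {c a : ℕ} (hw : ∀ v, w' v ≤ w v)
    (hg : ∀ v, w' (g v) ≤ w v + c) {P : MvPolynomial σ ℂ} (hP : P ∈ weightLE w a) :
    shiftDerivation g P ∈ weightLE w' (a + c) := by
  rw [P.as_sum, map_sum]
  refine Submodule.sum_mem _ fun m hm => ?_
  rw [shiftDerivation, MvPolynomial.mkDerivation_monomial]
  refine Submodule.smul_mem _ _ (Submodule.sum_mem _ fun i hi => ?_)
  simp only [smul_eq_mul, MvPolynomial.X, MvPolynomial.monomial_mul]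
  refine monomial_mem_weightLE ?_ _
  have h1 : Finsupp.weight w m = Finsupp.weight w (m - Finsupp.single i 1) + w i := by
    have : m = (m - Finsupp.single i 1) + Finsupp.single i 1 := by
      rw [tsub_add_cancel_of_le]
      simpa [Finsupp.single_le_iff, Nat.one_le_iff_ne_zero] using hi
    conv_lhs => rw [this]
    rw [map_add]
    simp [Finsupp.weight_single]
  have h2 := hP m hm
  have h3 := weight_mono hw (m - Finsupp.single i 1)
  have h4 := hg i
  simp only [map_add, Finsupp.weight_single, smul_eq_mul, one_mul]
  omega

end WeightFiltration

/-! ### The filtration of jet polynomials by order, weight and total degree. -/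

section JetFiltration

variable {n : ℕ}

lemma order_add_single (β : Fin n → ℕ) (j : Fin n) : order (β + Pi.single j 1) = order β + 1 := by
  simp [order, Finset.sum_add_distrib]

@[simp] lemma order_single (j : Fin n) : order (Pi.single j 1 : Fin n → ℕ) = 1 := by
  simp [order]

@[simp] lemma order_zero : order (0 : Fin n → ℕ) = 0 := by simp [order]

open Classical in
/-- The weight `0` for the derivatives `ρ_{z^β w^s}` with `0 < |β| + s ≤ k`, `|β| < k`, and the
weight `1` for the others. -/
noncomputable def lowerIndicator (n k : ℕ) (v : (Fin n → ℕ) × ℕ) : ℕ :=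
  if 0 < order v.1 + v.2 ∧ order v.1 + v.2 ≤ k ∧ order v.1 < k then 0 else 1

/-- The polynomials in the derivatives `ρ_{z^β w^s}` with `0 < |β| + s ≤ k`, `|β| < k`, of weight
at most `a` and of total degree at most `d`. -/
noncomputable def jetLE (n k a d : ℕ) : Submodule ℂ (JetPoly n) :=
  weightLE (lowerIndicator n k) 0 ⊓ weightLE (fun v => 2 * order v.1 + v.2 - 1) a ⊓
    weightLE (fun _ => 1) d

lemma lowerIndicator_anti {k k' : ℕ} (h : k ≤ k') (v : (Fin n → ℕ) × ℕ) :
    lowerIndicator n k' v ≤ lowerIndicator n k v := by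
  unfold lowerIndicator
  split_ifs <;> omega

lemma jetLE_mono {k k' a a' d d' : ℕ} (hk : k ≤ k') (ha : a ≤ a') (hd : d ≤ d') :
    jetLE n k a d ≤ jetLE n k' a' d' := fun _ hP =>
  ⟨⟨weightLE_anti (lowerIndicator_anti hk) _ hP.1.1, weightLE_mono ha hP.1.2⟩,
    weightLE_mono hd hP.2⟩

lemma mem_jetLE_of_le {k k' a a' d d' : ℕ} {P : JetPoly n} (hP : P ∈ jetLE n k a d) (hk : k ≤ k')
    (ha : a ≤ a') (hd : d ≤ d') : P ∈ jetLE n k' a' d' := jetLE_mono hk ha hd hP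

lemma mul_mem_jetLE {k a b d e : ℕ} {P Q : JetPoly n} (hP : P ∈ jetLE n k a d)
    (hQ : Q ∈ jetLE n k b e) : P * Q ∈ jetLE n k (a + b) (d + e) :=
  ⟨⟨mul_mem_weightLE hP.1.1 hQ.1.1, mul_mem_weightLE hP.1.2 hQ.1.2⟩, mul_mem_weightLE hP.2 hQ.2⟩

lemma C_mem_jetLE (k : ℕ) (r : ℂ) : (MvPolynomial.C r : JetPoly n) ∈ jetLE n k 0 0 :=
  ⟨⟨C_mem_weightLE _ r, C_mem_weightLE _ r⟩, C_mem_weightLE _ r⟩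

lemma one_mem_jetLE (k : ℕ) : (1 : JetPoly n) ∈ jetLE n k 0 0 := by
  simpa using C_mem_jetLE (n := n) k 1

lemma X_mem_jetLE {k a : ℕ} {β : Fin n → ℕ} {s : ℕ} (h0 : 0 < order β + s) (hk : order β + s ≤ k)
    (hβ : order β < k) (ha : 2 * order β + s - 1 ≤ a) :
    (MvPolynomial.X (β, s) : JetPoly n) ∈ jetLE n k a 1 :=
  ⟨⟨X_mem_weightLE (by simp [lowerIndicator, h0, hk, hβ]), X_mem_weightLE ha⟩,
    X_mem_weightLE le_rfl⟩

lemma prod_mem_jetLE {k a d : ℕ} {ι : Type*} (t : Finset ι) (P : ι → JetPoly n)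
    (hP : ∀ i ∈ t, P i ∈ jetLE n k a d) : ∏ i ∈ t, P i ∈ jetLE n k (t.card * a) (t.card * d) := by
  classical
  induction t using Finset.induction_on with
  | empty => simpa using one_mem_jetLE k
  | insert i t hi ih =>
    rw [Finset.prod_insert hi, Finset.card_insert_of_notMem hi, add_mul, add_mul, one_mul, one_mul,
      add_comm (_ * a), add_comm (_ * d)]
    exact mul_mem_jetLE (hP i (Finset.mem_insert_self _ _))
      (ih fun i hi => hP i (Finset.mem_insert_of_mem hi))

lemma pow_mem_jetLE {k a d : ℕ} {P : JetPoly n} (hP : P ∈ jetLE n k a d) (p : ℕ) :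
    P ^ p ∈ jetLE n k (p * a) (p * d) := by
  simpa using prod_mem_jetLE (Finset.range p) (fun _ => P) fun _ _ => hP

lemma det_mem_jetLE {k a d r : ℕ} (A : Matrix (Fin r) (Fin r) (JetPoly n))
    (hA : ∀ i j, A i j ∈ jetLE n k a d) : A.det ∈ jetLE n k (r * a) (r * d) := by
  rw [Matrix.det_apply]
  refine Submodule.sum_mem _ fun τ _ => ?_
  have := prod_mem_jetLE Finset.univ (fun i => A (τ i) i) fun i _ => hA _ _
  rw [Finset.card_fin] at this
  rcases Int.units_eq_one_or (Equiv.Perm.sign τ) with h | h <;> rw [h]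
  · simpa using this
  · simpa using this

/-- A monomial of `lowerIndicator` weight zero contains no variable of indicator 1. -/
lemma lowerOrder_of_mem_jetLE {k a d : ℕ} {P : JetPoly n} (hP : P ∈ jetLE n k a d) :
    P.LowerOrder k := by
  intro v hv
  obtain ⟨m, hm, hvm⟩ := (MvPolynomial.mem_vars_iff_mem_support v).1 hv
  have h := hP.1.1 m hm
  have h1 : m v * lowerIndicator n k v ≤ Finsupp.weight (lowerIndicator n k) m := by
    rw [Finsupp.weight_apply, Finsupp.sum]
    exact Finset.single_le_sum (f := fun i => m i • lowerIndicator n k i)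
      (fun _ _ => Nat.zero_le _) hvm
  have h2 : m v ≠ 0 := Finsupp.mem_support_iff.1 hvm
  have h3 : lowerIndicator n k v = 0 := by
    rcases Nat.mul_eq_zero.1 (Nat.le_zero.1 (h1.trans h)) with h | h
    exacts [absurd h h2, h]
  by_contra hcon
  rw [lowerIndicator, if_neg hcon] at h3
  exact one_ne_zero h3

lemma wt_le_of_mem_jetLE {k a d : ℕ} {P : JetPoly n} (hP : P ∈ jetLE n k a d) : P.wt ≤ a :=
  Finset.sup_le fun m hm => hP.1.2 m hm

/-- The filtration controls the total degree, which dominates the degree in ρ_w and, unlike it, is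
preserved by the formal derivations. -/
lemma degW_le_of_mem_jetLE {k a d : ℕ} {P : JetPoly n} (hP : P ∈ jetLE n k a d) : P.degW ≤ d := by
  refine MvPolynomial.degreeOf_le_iff.2 fun m hm => ?_
  refine le_trans ?_ (hP.2 m hm)
  by_cases h : (0, 1) ∈ m.support
  · rw [Finsupp.weight_apply, Finsupp.sum]
    have := Finset.single_le_sum (f := fun i => m i • 1) (fun _ _ => Nat.zero_le _) h
    simpa only [smul_eq_mul, mul_one] using this
  · simp [Finsupp.notMem_support_iff.1 h]

/-- The effect of `∂/∂z_j` on the indices of derivatives. -/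
def zShift (j : Fin n) (v : (Fin n → ℕ) × ℕ) : (Fin n → ℕ) × ℕ := (v.1 + Pi.single j 1, v.2)

/-- The effect of `∂/∂w` on the indices of derivatives. -/
def wShift (v : (Fin n → ℕ) × ℕ) : (Fin n → ℕ) × ℕ := (v.1, v.2 + 1)

lemma zDerivation_mem_jetLE {k a d : ℕ} {P : JetPoly n} (hP : P ∈ jetLE n k a d) (j : Fin n) :
    shiftDerivation (zShift j) P ∈ jetLE n (k + 1) (a + 2) d := by
  refine ⟨⟨?_, ?_⟩, ?_⟩
  · refine shiftDerivation_mem_weightLE (c := 0) (a := 0) (lowerIndicator_anti k.le_succ) (fun v => ?_) hP.1.1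
    unfold lowerIndicator zShift
    simp only [order_add_single]
    split_ifs <;> omega
  · refine shiftDerivation_mem_weightLE (fun _ => le_rfl) (fun v => ?_) hP.1.2
    simp only [zShift, order_add_single]
    omega
  · exact shiftDerivation_mem_weightLE (w := fun _ => 1) (w' := fun _ => 1) (c := 0) (a := d)
      (fun _ => Nat.le_refl 1) (fun _ => Nat.le_refl 1) hP.2

lemma wDerivation_mem_jetLE {k a d : ℕ} {P : JetPoly n} (hP : P ∈ jetLE n k a d) :
    shiftDerivation wShift P ∈ jetLE n (k + 1) (a + 1) d := by
  refine ⟨⟨?_, ?_⟩, ?_⟩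
  · refine shiftDerivation_mem_weightLE (c := 0) (a := 0) (lowerIndicator_anti k.le_succ) (fun v => ?_) hP.1.1
    unfold lowerIndicator wShift
    simp only
    split_ifs <;> omega
  · refine shiftDerivation_mem_weightLE (fun _ => le_rfl) (fun v => ?_) hP.1.2
    simp only [wShift]
    omega
  · exact shiftDerivation_mem_weightLE (w := fun _ => 1) (w' := fun _ => 1) (c := 0) (a := d)
      (fun _ => Nat.le_refl 1) (fun _ => Nat.le_refl 1) hP.2

end JetFiltration

/-! ### Implicit differentiation along the hypersurface {f = 0}. -/

section Tangential

variable {n : ℕ}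

/-- The value of a jet polynomial on the derivatives of `f` at `Z`. -/
noncomputable def evalJet (f : Cz n → ℂ) (Z : Cz n) : JetPoly n →+* ℂ :=
  MvPolynomial.eval fun v => mixedPartial v.1 v.2 f Z

lemma evalJet_X (f : Cz n → ℂ) (Z : Cz n) (v : (Fin n → ℕ) × ℕ) :
    evalJet f Z (MvPolynomial.X v) = mixedPartial v.1 v.2 f Z := MvPolynomial.eval_X ..

lemma evalJet_C (f : Cz n → ℂ) (Z : Cz n) (r : ℂ) :
    evalJet f Z (MvPolynomial.C r) = r := MvPolynomial.eval_C ..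

lemma dirDeriv_add' {e : Cz n} {a b : Cz n → ℂ} {Z : Cz n} (ha : DifferentiableAt ℂ a Z)
    (hb : DifferentiableAt ℂ b Z) :
    dirDeriv e (fun Z => a Z + b Z) Z = dirDeriv e a Z + dirDeriv e b Z := by
  simp only [dirDeriv]
  rw [fderiv_fun_add ha hb]
  rfl

lemma dirDeriv_mul' {e : Cz n} {a b : Cz n → ℂ} {Z : Cz n} (ha : DifferentiableAt ℂ a Z)
    (hb : DifferentiableAt ℂ b Z) :
    dirDeriv e (fun Z => a Z * b Z) Z = a Z * dirDeriv e b Z + b Z * dirDeriv e a Z := by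
  simp only [dirDeriv]
  rw [fderiv_fun_mul ha hb]
  rfl

lemma differentiableOn_evalJet {O : Set (Cz n)} (hO : IsOpen O) {f : Cz n → ℂ}
    (hf : DifferentiableOn ℂ f O) (P : JetPoly n) :
    DifferentiableOn ℂ (fun Z => evalJet f Z P) O := by
  induction P using MvPolynomial.induction_on with
  | C r => simp only [evalJet_C]; exact differentiableOn_const r
  | add P Q hP hQ => simp only [map_add]; exact hP.add hQ
  | mul_X P v hP =>
    simp only [map_mul, evalJet_X]
    exact hP.mul (differentiableOn_mixedPartial hO hf v.1 v.2)

/-- `g` describes the derivative in the direction `e` on the indices of derivatives. -/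
def IsShift (e : Cz n) (g : (Fin n → ℕ) × ℕ → (Fin n → ℕ) × ℕ) : Prop :=
  ∀ (O : Set (Cz n)) (f : Cz n → ℂ), IsOpen O → DifferentiableOn ℂ f O → ∀ v,
    EqOn (dirDeriv e (mixedPartial v.1 v.2 f)) (mixedPartial (g v).1 (g v).2 f) O

lemma isShift_zShift (j : Fin n) : IsShift (zUnit j) (zShift j) :=
  fun _ _ hO hf v => dirDeriv_zUnit_mixedPartial hO hf v.1 v.2 j

lemma isShift_wShift : IsShift (wUnit : Cz n) wShift :=
  fun _ _ hO hf v => dirDeriv_wUnit_mixedPartial hO hf v.1 v.2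

/-- As functions of P both sides obey the same Leibniz rule, and they agree on constants and
variables. -/
lemma dirDeriv_evalJet {O : Set (Cz n)} (hO : IsOpen O) {f : Cz n → ℂ}
    (hf : DifferentiableOn ℂ f O) {e : Cz n} {g : (Fin n → ℕ) × ℕ → (Fin n → ℕ) × ℕ}
    (hg : IsShift e g) (P : JetPoly n) {Z : Cz n} (hZ : Z ∈ O) :
    dirDeriv e (fun Z => evalJet f Z P) Z = evalJet f Z (shiftDerivation g P) := by
  have hd := fun P => (differentiableOn_evalJet hO hf P).differentiableAt (hO.mem_nhds hZ)
  induction P using MvPolynomial.induction_on with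
  | C r =>
    have : shiftDerivation g (MvPolynomial.C r) = 0 := MvPolynomial.derivation_C _ r
    simp [evalJet_C, dirDeriv, this]
  | add P Q hP hQ =>
    simp only [map_add]
    rw [dirDeriv_add' (hd P) (hd Q), hP, hQ]
  | mul_X P v hP =>
    simp only [map_mul, evalJet_X]
    rw [dirDeriv_mul' (hd P) ((differentiableOn_mixedPartial hO hf v.1 v.2).differentiableAt
      (hO.mem_nhds hZ)), hP, hg O f hO hf v hZ, Derivation.leibniz, shiftDerivation_X]
    simp [evalJet_X]

/-- The value of a linear differential expression in `F` whose coefficients are polynomials in the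
derivatives of `f`. -/
noncomputable def evalList (f F : Cz n → ℂ) (Z : Cz n)
    (S : List (JetPoly n × ((Fin n → ℕ) × ℕ))) : ℂ :=
  (S.map fun c => evalJet f Z c.1 * mixedPartial c.2.1 c.2.2 F Z).sum

lemma evalList_append (f F : Cz n → ℂ) (Z : Cz n) (S T : List (JetPoly n × ((Fin n → ℕ) × ℕ))) :
    evalList f F Z (S ++ T) = evalList f F Z S + evalList f F Z T := by
  simp [evalList]

lemma evalList_cons (f F : Cz n → ℂ) (Z : Cz n) (c : JetPoly n × ((Fin n → ℕ) × ℕ))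
    (S : List (JetPoly n × ((Fin n → ℕ) × ℕ))) :
    evalList f F Z (c :: S) =
      evalJet f Z c.1 * mixedPartial c.2.1 c.2.2 F Z + evalList f F Z S := by
  simp [evalList]

lemma evalList_nil (f F : Cz n → ℂ) (Z : Cz n) : evalList f F Z [] = 0 := rfl

lemma evalList_map_mul (f F : Cz n → ℂ) (Z : Cz n) (P : JetPoly n) (φ : JetPoly n → JetPoly n)
    (g : (Fin n → ℕ) × ℕ → (Fin n → ℕ) × ℕ) (S : List (JetPoly n × ((Fin n → ℕ) × ℕ))) :
    evalList f F Z (S.map fun c => (P * φ c.1, g c.2)) =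
      evalJet f Z P * evalList f F Z (S.map fun c => (φ c.1, g c.2)) := by
  simp only [evalList, List.map_map, ← List.sum_map_mul_left]
  congr 1
  refine List.map_congr_left fun c _ => ?_
  simp [mul_assoc]

lemma differentiableOn_evalList {O : Set (Cz n)} (hO : IsOpen O) {f F : Cz n → ℂ}
    (hf : DifferentiableOn ℂ f O) (hF : DifferentiableOn ℂ F O)
    (S : List (JetPoly n × ((Fin n → ℕ) × ℕ))) :
    DifferentiableOn ℂ (fun Z => evalList f F Z S) O := by
  induction S with
  | nil => simp only [evalList_nil]; exact differentiableOn_const 0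
  | cons c S ih =>
    simp only [evalList_cons]
    exact ((differentiableOn_evalJet hO hf c.1).mul
      (differentiableOn_mixedPartial hO hF c.2.1 c.2.2)).add ih

lemma dirDeriv_evalList {O : Set (Cz n)} (hO : IsOpen O) {f F : Cz n → ℂ}
    (hf : DifferentiableOn ℂ f O) (hF : DifferentiableOn ℂ F O) {e : Cz n}
    {g : (Fin n → ℕ) × ℕ → (Fin n → ℕ) × ℕ} (hg : IsShift e g)
    (S : List (JetPoly n × ((Fin n → ℕ) × ℕ))) {Z : Cz n} (hZ : Z ∈ O) :
    dirDeriv e (fun Z => evalList f F Z S) Z =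
      evalList f F Z (S.map fun c => (shiftDerivation g c.1, c.2)) +
        evalList f F Z (S.map fun c => (c.1, g c.2)) := by
  induction S with
  | nil => simp [evalList_nil, dirDeriv]
  | cons c S ih =>
    have h1 := (differentiableOn_evalJet hO hf c.1).differentiableAt (hO.mem_nhds hZ)
    have h2 := (differentiableOn_mixedPartial hO hF c.2.1 c.2.2).differentiableAt (hO.mem_nhds hZ)
    have h3 := (differentiableOn_evalList hO hf hF S).differentiableAt (hO.mem_nhds hZ)
    simp only [evalList_cons, List.map_cons]
    rw [dirDeriv_add' (h1.fun_mul h2) h3, ih, dirDeriv_mul' h1 h2, dirDeriv_evalJet hO hf hg c.1 hZ,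
      hg O F hO hF c.2 hZ]
    ring

lemma exists_eq_add_single {α : Fin n → ℕ} {q : ℕ} (hα : order α = q + 1) :
    ∃ j β, order β = q ∧ α = β + Pi.single j 1 := by
  obtain ⟨j, hj⟩ : ∃ j, α j ≠ 0 := by
    by_contra! h
    simp [order, h] at hα
  have h : α = (α - Pi.single j 1) + Pi.single j 1 := by
    ext i
    by_cases hi : i = j
    · subst hi
      simp only [Pi.add_apply, Pi.sub_apply, Pi.single_eq_same]
      omega
    · simp [hi]
  refine ⟨j, α - Pi.single j 1, ?_, h⟩
  rw [h, order_add_single] at hα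
  omega

/-- Applying `|α|` times the vector fields tangent to `{f = 0}` to a function `F` vanishing on
`{f = 0}`: a linear relation between the derivatives of `F` whose coefficients are polynomials in
the derivatives of `f`. The derivative `f_{z^α}` only enters the coefficient of `F_w`. -/
theorem exists_tangential_relation (q : ℕ) : ∀ α : Fin n → ℕ, order α = q + 1 →
    ∃ (S : List (JetPoly n × ((Fin n → ℕ) × ℕ))) (E : JetPoly n),
      (∀ c ∈ S, c.1 ∈ jetLE n (q + 1) (2 * q) (2 * q) ∧ 0 < order c.2.1 + c.2.2) ∧
      E ∈ jetLE n (q + 1) (2 * q + 1) (2 * q + 1) ∧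
      ∀ (O : Set (Cz n)) (f F : Cz n → ℂ), IsOpen O → DifferentiableOn ℂ f O →
        DifferentiableOn ℂ F O → (∀ Z ∈ O, dirDeriv wUnit f Z ≠ 0) →
        (∀ Z ∈ O, f Z = 0 → F Z = 0) → ∀ Z ∈ O, f Z = 0 →
          dirDeriv wUnit f Z * evalList f F Z S +
            evalJet f Z (E - MvPolynomial.X (0, 1) ^ (2 * q) * MvPolynomial.X (α, 0)) *
              dirDeriv wUnit F Z = 0 := by
  induction q with
  | zero =>
    intro α hα
    obtain ⟨j, β, hβ, rfl⟩ := exists_eq_add_single hα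
    obtain rfl : β = 0 := by
      ext i
      exact Finset.sum_eq_zero_iff.1 hβ i (Finset.mem_univ i)
    refine ⟨[(1, (Pi.single j 1, 0))], 0, ?_, Submodule.zero_mem _, ?_⟩
    · intro c hc
      obtain rfl := List.mem_singleton.1 hc
      exact ⟨jetLE_mono (Nat.zero_le _) le_rfl le_rfl (one_mem_jetLE 0), by simp⟩
    · intro O f F hO hf hF hw hfF Z hZ hfZ
      have := fderiv_mul_sub_eq_zero hO hf hF hfF (u := zUnit j) hZ hfZ (hw Z hZ)
      simp only [evalList_cons, evalList_nil, map_sub, map_mul, map_pow, evalJet_X, map_one,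
        map_zero, zero_add, mixedPartial_single hO hf j hZ, mixedPartial_single hO hF j hZ]
      simp only [dirDeriv] at this ⊢
      linear_combination this
  | succ q ih =>
    intro α hα
    obtain ⟨j, β, hβ, rfl⟩ := exists_eq_add_single hα
    obtain ⟨S, E, hS, hE, hrel⟩ := ih β hβ
    set X : (Fin n → ℕ) → ℕ → JetPoly n := fun β s => MvPolynomial.X (β, s) with hX
    set G : JetPoly n := E - X 0 1 ^ (2 * q) * X β 0 with hG
    set ej : Fin n → ℕ := Pi.single j 1 with hej
    set dz : JetPoly n → JetPoly n := fun P => shiftDerivation (zShift j) P with hdz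
    set dw : JetPoly n → JetPoly n := fun P => shiftDerivation wShift P with hdw
    set D : JetPoly n → JetPoly n := fun P => X 0 1 * dz P - X ej 0 * dw P with hD
    set B : JetPoly n := X 0 1 * X ej 1 - X ej 0 * X 0 2 with hB
    have hw : X 0 1 ∈ jetLE n (q + 1 + 1) 0 1 :=
      X_mem_jetLE (by simp) (by simp) (by simp) (by simp)
    have hj : X ej 0 ∈ jetLE n (q + 1 + 1) 1 1 :=
      X_mem_jetLE (by simp [hej]) (by simp [hej]) (by simp [hej]) (by simp [hej])
    have hj1 : X ej 1 ∈ jetLE n (q + 1 + 1) 2 1 :=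
      X_mem_jetLE (by simp) (by simp [hej]) (by simp [hej]) (by simp [hej])
    have hw2 : X 0 2 ∈ jetLE n (q + 1 + 1) 1 1 :=
      X_mem_jetLE (by simp) (by simp) (by simp) (by simp)
    have hBmem : B ∈ jetLE n (q + 1 + 1) 2 2 :=
      Submodule.sub_mem _ (mem_jetLE_of_le (mul_mem_jetLE hw hj1) le_rfl (by omega) (by omega))
        (mem_jetLE_of_le (mul_mem_jetLE hj hw2) le_rfl (by omega) (by omega))
    have hXβ : X β 0 ∈ jetLE n (q + 1 + 1) (2 * q + 1) 1 :=
      X_mem_jetLE (by omega) (by omega) (by omega) (by omega)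
    have hGmem : G ∈ jetLE n (q + 1 + 1) (2 * q + 1) (2 * q + 1) :=
      Submodule.sub_mem _ (mem_jetLE_of_le hE (Nat.le_succ _) le_rfl le_rfl)
        (mem_jetLE_of_le (mul_mem_jetLE (pow_mem_jetLE hw (2 * q)) hXβ) le_rfl (by omega)
          (by omega))
    have hDmem : ∀ {a d : ℕ} {P : JetPoly n}, P ∈ jetLE n (q + 1) a d →
        D P ∈ jetLE n (q + 1 + 1) (a + 2) (d + 1) := fun hP =>
      Submodule.sub_mem _ (mem_jetLE_of_le (mul_mem_jetLE hw (zDerivation_mem_jetLE hP j)) le_rfl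
          (by omega) (by omega))
        (mem_jetLE_of_le (mul_mem_jetLE hj (wDerivation_mem_jetLE hP)) le_rfl (by omega)
          (by omega))
    -- Write D = f_w ∂_j - f_j ∂_w, B = D f_w, L for the expression S and T = f_w L + G F_w for the
    -- old relation. The new relation is f_w · DT - (2q+1) B T, that is, D(T / f_w^(2q+1)) with
    -- denominators cleared. Its part divisible by f_w is f_w (f_w DL - 2q B L + G · D F_w), which
    -- is the list; the coefficient of F_w is f_w DG - (2q+1) B G, where the term with f_{z^α} is
    -- split off from E.
    refine ⟨(S.map fun c => (X 0 1 ^ 2 * dz c.1, c.2)) ++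
      (S.map fun c => (-(X 0 1 * X ej 0) * dw c.1, c.2)) ++
      (S.map fun c => (-(MvPolynomial.C (2 * q : ℂ) * B) * c.1, c.2)) ++
      (S.map fun c => (X 0 1 ^ 2 * c.1, zShift j c.2)) ++
      (S.map fun c => (-(X 0 1 * X ej 0) * c.1, wShift c.2)) ++
      [(X 0 1 * G, (ej, 1)), (-(X ej 0) * G, (0, 2))],
      X 0 1 * D E - X 0 1 * (X β 0 * D (X 0 1 ^ (2 * q))) + X 0 1 ^ (2 * q + 1) * (X ej 0 * X β 1)
        - MvPolynomial.C (2 * q + 1 : ℂ) * (B * G), ?_, ?_, ?_⟩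
    · have hS1 : ∀ c ∈ S, c.1 ∈ jetLE n (q + 1 + 1) (2 * q) (2 * q) := fun c hc =>
        jetLE_mono (Nat.le_succ _) le_rfl le_rfl (hS c hc).1
      simp only [List.mem_append, List.mem_map, List.mem_cons, List.not_mem_nil, or_false]
      rintro c (((((⟨c, hc, rfl⟩ | ⟨c, hc, rfl⟩) | ⟨c, hc, rfl⟩) | ⟨c, hc, rfl⟩) | ⟨c, hc, rfl⟩) |
        rfl | rfl)
      · exact ⟨mem_jetLE_of_le (mul_mem_jetLE (pow_mem_jetLE hw 2)
          (zDerivation_mem_jetLE (hS c hc).1 j)) le_rfl (by omega) (by omega), (hS c hc).2⟩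
      · exact ⟨mem_jetLE_of_le (mul_mem_jetLE (Submodule.neg_mem _ (mul_mem_jetLE hw hj))
          (wDerivation_mem_jetLE (hS c hc).1)) le_rfl (by omega) (by omega), (hS c hc).2⟩
      · exact ⟨mem_jetLE_of_le (mul_mem_jetLE (Submodule.neg_mem _ (mul_mem_jetLE
          (C_mem_jetLE _ _) hBmem)) (hS1 c hc)) le_rfl (by omega) (by omega), (hS c hc).2⟩
      · exact ⟨mem_jetLE_of_le (mul_mem_jetLE (pow_mem_jetLE hw 2) (hS1 c hc)) le_rfl (by omega)
          (by omega), by simp [zShift, order_add_single]⟩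
      · exact ⟨mem_jetLE_of_le (mul_mem_jetLE (Submodule.neg_mem _ (mul_mem_jetLE hw hj))
          (hS1 c hc)) le_rfl (by omega) (by omega), by simp [wShift]⟩
      · exact ⟨mem_jetLE_of_le (mul_mem_jetLE hw hGmem) le_rfl (by omega) (by omega), by simp⟩
      · exact ⟨mem_jetLE_of_le (mul_mem_jetLE (Submodule.neg_mem _ hj) hGmem) le_rfl (by omega)
          (by omega), by simp⟩
    · have hw1 : X 0 1 ∈ jetLE n (q + 1) 0 1 :=
        X_mem_jetLE (by simp) (by simp) (by simp) (by simp)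
      have hXβ1 : X β 1 ∈ jetLE n (q + 1 + 1) (2 * q + 2) 1 :=
        X_mem_jetLE (by omega) (by omega) (by omega) (by omega)
      exact Submodule.sub_mem _ (Submodule.add_mem _ (Submodule.sub_mem _
        (mem_jetLE_of_le (mul_mem_jetLE hw (hDmem hE)) le_rfl (by omega) (by omega))
        (mem_jetLE_of_le (mul_mem_jetLE hw (mul_mem_jetLE hXβ (hDmem (pow_mem_jetLE hw1 (2 * q)))))
          le_rfl (by omega) (by omega)))
        (mem_jetLE_of_le (mul_mem_jetLE (pow_mem_jetLE hw (2 * q + 1)) (mul_mem_jetLE hj hXβ1))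
          le_rfl (by omega) (by omega)))
        (mem_jetLE_of_le (mul_mem_jetLE (C_mem_jetLE _ _) (mul_mem_jetLE hBmem hGmem)) le_rfl
          (by omega) (by omega))
    · intro O f F hO hf hF hw hfF Z hZ hfZ
      have hT0 := hrel O f F hO hf hF hw hfF
      simp only [← mixedPartial_zero_one] at hT0 hw ⊢
      have hfw := differentiableOn_mixedPartial hO hf 0 1
      have hFw := differentiableOn_mixedPartial hO hF 0 1
      have hL := differentiableOn_evalList hO hf hF S
      have hGd := differentiableOn_evalJet hO hf G
      have hTd := (hfw.fun_mul hL).fun_add (hGd.fun_mul hFw)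
      -- The old relation itself vanishes on {f = 0}, so the tangential field annihilates it there.
      have hT := fderiv_mul_sub_eq_zero hO hf hTd hT0 (u := zUnit j) (v := wUnit) hZ hfZ
        (by rw [mixedPartial_zero_one] at hw; exact hw Z hZ)
      have hderiv : ∀ (e : Cz n) (g : (Fin n → ℕ) × ℕ → (Fin n → ℕ) × ℕ), IsShift e g →
          fderiv ℂ (fun Z => mixedPartial 0 1 f Z * evalList f F Z S +
            evalJet f Z G * mixedPartial 0 1 F Z) Z e =
          mixedPartial 0 1 f Z * (evalList f F Z (S.map fun c => (shiftDerivation g c.1, c.2)) +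
            evalList f F Z (S.map fun c => (c.1, g c.2))) +
          evalList f F Z S * mixedPartial (g (0, 1)).1 (g (0, 1)).2 f Z +
          (evalJet f Z G * mixedPartial (g (0, 1)).1 (g (0, 1)).2 F Z +
            mixedPartial 0 1 F Z * evalJet f Z (shiftDerivation g G)) := by
        intro e g hg
        have hn := hO.mem_nhds hZ
        have h1 := hfw.differentiableAt hn
        have h2 := hL.differentiableAt hn
        have h3 := hGd.differentiableAt hn
        have h4 := hFw.differentiableAt hn
        have h5 := dirDeriv_add' (e := e) (h1.fun_mul h2) (h3.fun_mul h4)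
        rw [dirDeriv_mul' h1 h2, dirDeriv_mul' h3 h4, dirDeriv_evalList hO hf hF hg S hZ,
          dirDeriv_evalJet hO hf hg G hZ, hg O f hO hf (0, 1) hZ, hg O F hO hF (0, 1) hZ] at h5
        exact h5
      rw [hderiv _ _ (isShift_zShift j), hderiv _ _ isShift_wShift] at hT
      have e1 : fderiv ℂ f Z wUnit = mixedPartial 0 1 f Z := by
        rw [mixedPartial_zero_one]; rfl
      have e2 : fderiv ℂ f Z (zUnit j) = mixedPartial ej 0 f Z :=
        (mixedPartial_single hO hf j hZ).symm
      rw [e1, e2] at hT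
      have s1 : zShift j ((0 : Fin n → ℕ), 1) = (ej, 1) := by simp [zShift, hej]
      have s2 : wShift ((0 : Fin n → ℕ), 1) = (0, 2) := rfl
      rw [s1, s2] at hT
      have hE' : X 0 1 * D E - X 0 1 * (X β 0 * D (X 0 1 ^ (2 * q))) +
          X 0 1 ^ (2 * q + 1) * (X ej 0 * X β 1) - MvPolynomial.C (2 * q + 1 : ℂ) * (B * G) -
          X 0 1 ^ (2 * (q + 1)) * X (β + ej) 0 =
          X 0 1 * D G - MvPolynomial.C (2 * q + 1 : ℂ) * (B * G) := by
        have hDG : D G = D E - (X 0 1 ^ (2 * q) * D (X β 0) + X β 0 * D (X 0 1 ^ (2 * q))) := by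
          simp only [hD, hdz, hdw, hG, map_sub, Derivation.leibniz, smul_eq_mul]
          ring
        have hDX : D (X β 0) = X 0 1 * X (β + ej) 0 - X ej 0 * X β 1 := by
          simp only [hD, hdz, hdw, hX, shiftDerivation_X]
          rfl
        rw [hDG, hDX]
        ring
      rw [hE']
      have l1 := evalList_map_mul f F Z (X 0 1 ^ 2) dz id S
      have l2 := evalList_map_mul f F Z (-(X 0 1 * X ej 0)) dw id S
      have l3 := evalList_map_mul f F Z (-(MvPolynomial.C (2 * q : ℂ) * B)) id id S
      have l4 := evalList_map_mul f F Z (X 0 1 ^ 2) id (zShift j) S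
      have l5 := evalList_map_mul f F Z (-(X 0 1 * X ej 0)) id wShift S
      simp only [id] at l1 l2 l3 l4 l5
      rw [evalList_append, evalList_append, evalList_append, evalList_append, evalList_append,
        l1, l2, l3, l4, l5]
      simp only [evalList_cons, evalList_nil, hD, hdz, hdw, hB, List.map_id', map_sub, map_mul,
        map_pow, map_neg, hX, evalJet_X, evalJet_C, Prod.mk.eta]
      have hT0Z := hT0 Z hZ hfZ
      linear_combination mixedPartial 0 1 f Z * hT - (2 * q + 1) * (mixedPartial 0 1 f Z *
        mixedPartial ej 1 f Z - mixedPartial ej 0 f Z * mixedPartial 0 2 f Z) * hT0Z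

end Tangential

/-! ### Linear dependence of polynomial vectors, expressed by minors. -/

section Minors

variable {n : ℕ}

/-- Among vectors depending on a parameter and graded by `d`, too many to be independent, there
are a degree `k` and a family of vectors of degree at most `k` which is independent for some
parameter, and becomes dependent for all parameters when one vector of degree `k` is added. -/
lemma exists_minimal_dependent {ι V κ : Type*} [Nonempty ι] [Fintype κ] [DecidableEq κ]
    [AddCommGroup V] [Module ℂ V] (d : κ → ℕ) (U : ι → κ → V)
    (hU : ∀ i, ¬ LinearIndepOn ℂ (U i) univ) :
    ∃ (I : Finset κ) (j₀ : κ), j₀ ∉ I ∧ (∀ j ∈ I, d j ≤ d j₀) ∧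
      (∃ i, LinearIndepOn ℂ (U i) (I : Set κ)) ∧
      ∀ i, ¬ LinearIndepOn ℂ (U i) (insert j₀ I : Finset κ) := by
  classical
  have hex : ∃ k, ∀ i, ¬ LinearIndepOn ℂ (U i) {j | d j ≤ k} := by
    refine ⟨Finset.univ.sup d, fun i => ?_⟩
    convert! hU i
    exact eq_univ_of_forall fun j => Finset.le_sup (f := d) (Finset.mem_univ j)
  obtain ⟨k, hk, hmin⟩ : ∃ k, (∀ i, ¬ LinearIndepOn ℂ (U i) {j | d j ≤ k}) ∧
      ∀ k' < k, ∃ i, LinearIndepOn ℂ (U i) {j | d j ≤ k'} :=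
    ⟨Nat.find hex, Nat.find_spec hex, fun k' hk' => by
      have := Nat.find_min hex hk'
      push Not at this
      exact this⟩
  -- Here k is the least degree at which the vectors become dependent for every parameter. A largest
  -- I containing all lower degrees and independent for some parameter cannot exhaust degree k; a
  -- missing vector then has degree exactly k, and by maximality adding it destroys independence
  -- everywhere.
  let 𝓘 : Finset (Finset κ) := Finset.univ.filter fun I =>
    (∀ j, d j < k → j ∈ I) ∧ (∀ j ∈ I, d j ≤ k) ∧ ∃ i, LinearIndepOn ℂ (U i) (I : Set κ)
  have h𝓘 : 𝓘.Nonempty := by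
    refine ⟨Finset.univ.filter fun j => d j < k, ?_⟩
    simp only [𝓘, Finset.mem_filter, Finset.mem_univ, true_and]
    refine ⟨fun j hj => hj, fun j hj => hj.le, ?_⟩
    rcases Nat.eq_zero_or_pos k with h0 | hpos
    · obtain ⟨i⟩ := ‹Nonempty ι›
      refine ⟨i, ?_⟩
      have : ((Finset.univ.filter fun j => d j < k : Finset κ) : Set κ) = ∅ := by
        ext j; simp [h0]
      rw [this]
      exact linearIndepOn_empty ℂ (U i)
    · obtain ⟨i, hi⟩ := hmin (k - 1) (by omega)
      refine ⟨i, ?_⟩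
      convert! hi
      ext j
      simp
      omega
  obtain ⟨I, hI, hmax⟩ := Finset.exists_max_image 𝓘 Finset.card h𝓘
  simp only [𝓘, Finset.mem_filter, Finset.mem_univ, true_and] at hI hmax
  obtain ⟨hI1, hI2, i₁, hi₁⟩ := hI
  obtain ⟨j₀, hj₀k, hj₀I⟩ : ∃ j₀, d j₀ ≤ k ∧ j₀ ∉ I := by
    by_contra! hcon
    refine hk i₁ ?_
    convert! hi₁
    ext j
    exact ⟨hcon j, hI2 j⟩
  have hdk : d j₀ = k := le_antisymm hj₀k (not_lt.1 fun h => hj₀I (hI1 j₀ h))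
  refine ⟨I, j₀, hj₀I, fun j hj => hdk ▸ hI2 j hj, ⟨i₁, hi₁⟩, fun i hi => ?_⟩
  have := hmax (insert j₀ I) ⟨fun j hj => Finset.mem_insert_of_mem (hI1 j hj), fun j hj => ?_, i, hi⟩
  · rw [Finset.card_insert_of_notMem hj₀I] at this
    omega
  · rcases Finset.mem_insert.1 hj with rfl | h
    exacts [hj₀k, hI2 j h]

/-- Polynomial vectors, independent at some point, that become dependent everywhere when one
vector is added, satisfy a linear relation with polynomial coefficients (minors), in which the
coefficient of the additional vector is not identically zero. -/
lemma exists_minor_relation {ι : Type*} {m r k a d : ℕ} (x : ι → (Fin n → ℕ) × ℕ → ℂ)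
    (u : Fin (r + 1) → Fin m → JetPoly n) (hu : ∀ p b, u p b ∈ jetLE n k a d) (i₁ : ι)
    (hind : LinearIndependent ℂ fun (p : Fin r) b => MvPolynomial.eval (x i₁) (u p.succ b))
    (hdep : ∀ i, ¬ LinearIndependent ℂ fun p b => MvPolynomial.eval (x i) (u p b)) :
    ∃ c : Fin (r + 1) → JetPoly n, (∀ p, c p ∈ jetLE n k (r * a) (r * d)) ∧
      MvPolynomial.eval (x i₁) (c 0) ≠ 0 ∧
      ∀ i b, ∑ p, MvPolynomial.eval (x i) (c p) * MvPolynomial.eval (x i) (u p b) = 0 := by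
  -- A constant left inverse taken at i₁ replaces a choice of r coordinates. At i₁ the projected
  -- block of independent vectors is the identity matrix, so its minor has the value 1.
  obtain ⟨B, hB⟩ := LinearMap.exists_leftInverse_of_injective
    (Fintype.linearCombination ℂ fun (p : Fin r) b => MvPolynomial.eval (x i₁) (u p.succ b))
    (LinearMap.ker_eq_bot.2 (linearIndependent_iff_injective_fintypeLinearCombination.1 hind))
  let Bm := LinearMap.toMatrix' B
  let M : Matrix (Fin (r + 1)) (Fin r) (JetPoly n) :=
    Matrix.of fun p q => ∑ b, MvPolynomial.C (Bm q b) * u p b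
  have hM : ∀ p q, M p q ∈ jetLE n k a d := fun p q => by
    simp only [M, Matrix.of_apply]
    refine Submodule.sum_mem _ fun b _ => ?_
    simpa using mul_mem_jetLE (C_mem_jetLE k (Bm q b)) (hu p b)
  have hMev : ∀ i p q, MvPolynomial.eval (x i) (M p q) =
      B (fun b => MvPolynomial.eval (x i) (u p b)) q := by
    intro i p q
    have : B (fun b => MvPolynomial.eval (x i) (u p b)) =
        Bm.mulVec (fun b => MvPolynomial.eval (x i) (u p b)) := by
      rw [← Matrix.toLin'_apply]
      simp [Bm]
    rw [this]
    simp [M, Matrix.mulVec, dotProduct]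
  refine ⟨fun p => (-1) ^ (p : ℕ) * (M.submatrix p.succAbove id).det, fun p => ?_, ?_, ?_⟩
  · have h1 : ((-1 : JetPoly n)) ^ (p : ℕ) ∈ jetLE n k 0 0 := by
      simpa using pow_mem_jetLE (Submodule.neg_mem _ (one_mem_jetLE (n := n) k)) (p : ℕ)
    simpa using mul_mem_jetLE h1 (det_mem_jetLE (M.submatrix p.succAbove id) fun i j => hM _ _)
  · simp only [Fin.val_zero, pow_zero, one_mul]
    rw [RingHom.map_det]
    have : (MvPolynomial.eval (x i₁)).mapMatrix (M.submatrix (Fin.succAbove 0) id) = 1 := by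
      ext p q
      simp only [RingHom.mapMatrix_apply, Matrix.map_apply, Matrix.submatrix_apply, id, hMev,
        Fin.zero_succAbove]
      have := LinearMap.congr_fun hB (Pi.single p 1)
      simp only [LinearMap.comp_apply, Fintype.linearCombination_apply_single, one_smul,
        LinearMap.id_apply] at this
      rw [this, Matrix.one_apply, Pi.single_apply]
      simp [eq_comm]
    rw [this, Matrix.det_one]
    exact one_ne_zero
  · intro i b
    -- Prefixing the b-th coordinate as a column gives a square matrix with dependent rows at every
    -- parameter; expanding its determinant along that column is the desired relation.
    let A : Matrix (Fin (r + 1)) (Fin (r + 1)) (JetPoly n) :=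
      Matrix.of fun p => Fin.cons (u p b) (M p)
    have hA : A.det = ∑ p : Fin (r + 1), (-1) ^ (p : ℕ) * (M.submatrix p.succAbove id).det * u p b := by
      rw [Matrix.det_succ_column_zero]
      refine Finset.sum_congr rfl fun p _ => ?_
      have : A.submatrix p.succAbove Fin.succ = M.submatrix p.succAbove id := by
        ext s t
        simp [A]
      rw [this]
      simp only [A, Matrix.of_apply, Fin.cons_zero]
      ring
    have h0 : MvPolynomial.eval (x i) A.det = 0 := by
      rw [RingHom.map_det]
      obtain ⟨g, hg, p₀, hp₀⟩ := Fintype.not_linearIndependent_iff.1 (hdep i)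
      refine Matrix.exists_vecMul_eq_zero_iff.1 ⟨g, fun h => hp₀ (by simp [h]), ?_⟩
      ext q
      simp only [Matrix.vecMul, dotProduct, RingHom.mapMatrix_apply, Matrix.map_apply,
        Pi.zero_apply]
      refine Fin.cases ?_ (fun q => ?_) q
      · have := congrFun hg b
        simpa [A, Finset.sum_apply] using this
      · simp only [A, Matrix.of_apply, Fin.cons_succ, hMev]
        have := congrFun (congrArg B hg) q
        simpa [map_sum, Finset.sum_apply] using this
    rw [hA, map_sum] at h0
    simpa only [map_mul] using h0

end Minors

/-! ### Eliminating the embedding by linear algebra. -/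

section PolynomialRelation

variable {n m : ℕ} {E : Type*} [AddCommGroup E] [Module ℂ E]

/-- The polynomial obtained by applying a linear form to a vector with polynomial coefficients. -/
noncomputable def formPoly (h : (Fin n → ℕ) × ℕ → E) (S : List (JetPoly n × ((Fin n → ℕ) × ℕ)))
    (φ : E →ₗ[ℂ] ℂ) : JetPoly n :=
  (S.map fun c => MvPolynomial.C (φ (h c.2)) * c.1).sum

lemma formPoly_mem_jetLE {k a d : ℕ} (h : (Fin n → ℕ) × ℕ → E)
    (S : List (JetPoly n × ((Fin n → ℕ) × ℕ))) (φ : E →ₗ[ℂ] ℂ)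
    (hS : ∀ c ∈ S, c.1 ∈ jetLE n k a d) : formPoly h S φ ∈ jetLE n k a d := by
  refine list_sum_mem fun P hP => ?_
  obtain ⟨c, hc, rfl⟩ := List.mem_map.1 hP
  simpa using mul_mem_jetLE (C_mem_jetLE k (φ (h c.2))) (hS c hc)

/-- The value of a vector with polynomial coefficients. -/
noncomputable def vectorValue (x : (Fin n → ℕ) × ℕ → ℂ) (h : (Fin n → ℕ) × ℕ → E)
    (S : List (JetPoly n × ((Fin n → ℕ) × ℕ))) : E :=
  (S.map fun c => MvPolynomial.eval x c.1 • h c.2).sum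

lemma apply_vectorValue (x : (Fin n → ℕ) × ℕ → ℂ) (h : (Fin n → ℕ) × ℕ → E)
    (S : List (JetPoly n × ((Fin n → ℕ) × ℕ))) (φ : E →ₗ[ℂ] ℂ) :
    φ (vectorValue x h S) = (S.map fun c => MvPolynomial.eval x c.1 * φ (h c.2)).sum := by
  simp [vectorValue, map_list_sum, Function.comp_def]

lemma eval_formPoly (x : (Fin n → ℕ) × ℕ → ℂ) (h : (Fin n → ℕ) × ℕ → E)
    (S : List (JetPoly n × ((Fin n → ℕ) × ℕ))) (φ : E →ₗ[ℂ] ℂ) :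
    MvPolynomial.eval x (formPoly h S φ) = φ (vectorValue x h S) := by
  rw [apply_vectorValue, formPoly, map_list_sum, List.map_map]
  congr 1
  refine List.map_congr_left fun c _ => ?_
  simp [mul_comm]

/-- Linear algebra behind the theorem: from the tangential relations for the multiindices `α j` to
one polynomial relation between the derivatives `x i`. -/
theorem exists_polynomial_relation [FiniteDimensional ℂ E] (hE : Module.finrank ℂ E = n + m + 1)
    (T : Cz n →ₗ[ℂ] E) (hT : Function.Injective T) (h : (Fin n → ℕ) × ℕ → E)
    {ι : Type*} [Nonempty ι] (x : ι → (Fin n → ℕ) × ℕ → ℂ) (ν : ι → E →ₗ[ℂ] ℂ)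
    (hx : ∀ i, x i (0, 1) ≠ 0) (hν : ∀ i, ν i (T wUnit) ≠ 0)
    (hνT : ∀ i p, x i (0, 1) * ν i (T p) =
      (∑ j, x i (Pi.single j 1, 0) * p.1 j + x i (0, 1) * p.2) * ν i (T wUnit))
    (α : Fin (m + 1) → Fin n → ℕ) (hα : ∀ j, 2 ≤ order (α j))
    (S : Fin (m + 1) → List (JetPoly n × ((Fin n → ℕ) × ℕ))) (G : Fin (m + 1) → JetPoly n)
    (hS : ∀ j, ∀ c ∈ S j,
      c.1 ∈ jetLE n (order (α j)) (2 * order (α j) - 2) (2 * order (α j) - 2))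
    (hG : ∀ j, G j ∈ jetLE n (order (α j)) (2 * order (α j) - 1) (2 * order (α j) - 1))
    (hrel : ∀ i j, x i (0, 1) * ν i (vectorValue (x i) h (S j)) +
      MvPolynomial.eval (x i) (G j - MvPolynomial.X (0, 1) ^ (2 * order (α j) - 2) *
        MvPolynomial.X (α j, 0)) * ν i (T wUnit) = 0) :
    ∃ k l : ℕ,
      (∃ j, order (α j) = k) ∧
      l = (Finset.univ.filter (fun j => order (α j) ≤ k)).card ∧
      ∃ (P : Fin (m + 1) → JetPoly n) (R : JetPoly n),
        (∀ i, ∑ j ∈ Finset.univ.filter (fun j => order (α j) = k),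
            MvPolynomial.eval (x i) (P j) * x i (α j, 0) = MvPolynomial.eval (x i) R) ∧
        (∃ j, order (α j) = k ∧ ∃ i, MvPolynomial.eval (x i) (P j) ≠ 0) ∧
        (∀ j, P j ∈ jetLE n k ((2 * k - 2) * (l - 1)) ((2 * k - 2) * l)) ∧
        R ∈ jetLE n k ((2 * k - 2) * l + 1) ((2 * k - 2) * l + 1) := by
  classical
  obtain ⟨π, hπ⟩ : ∃ π : E →ₗ[ℂ] (Fin m → ℂ), LinearMap.ker π = LinearMap.range T := by
    have h1 : Module.finrank ℂ (LinearMap.range T) = n + 1 := by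
      rw [LinearMap.finrank_range_of_inj hT]
      simp
    have h2 := Submodule.finrank_quotient_add_finrank (LinearMap.range T)
    have h3 : Module.finrank ℂ (E ⧸ LinearMap.range T) = Module.finrank ℂ (Fin m → ℂ) := by
      rw [Module.finrank_fin_fun]
      omega
    refine ⟨(LinearEquiv.ofFinrankEq _ _ h3).toLinearMap ∘ₗ (LinearMap.range T).mkQ, ?_⟩
    rw [LinearEquiv.ker_comp, Submodule.ker_mkQ]
  obtain ⟨Λ, hΛ⟩ := LinearMap.exists_leftInverse_of_injective T (LinearMap.ker_eq_bot.2 hT)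
  -- the components transversal to the range of `T`, and the component along `T wUnit`
  let u : Fin (m + 1) → Fin m → JetPoly n := fun j b =>
    formPoly h (S j) (LinearMap.proj b ∘ₗ π)
  -- The added terms are df applied to the Λ-component of the vector. This is what f_w ν
  -- contributes, in units of ν(T ∂_w), once a combination lies in the image of T.
  let g : Fin (m + 1) → JetPoly n := fun j => G j +
    (∑ i, MvPolynomial.X (Pi.single i 1, 0) *
      formPoly h (S j) (LinearMap.proj i ∘ₗ LinearMap.fst ℂ _ _ ∘ₗ Λ) +
      MvPolynomial.X (0, 1) * formPoly h (S j) (LinearMap.snd ℂ _ _ ∘ₗ Λ))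
  have hg : ∀ j, g j ∈ jetLE n (order (α j)) (2 * order (α j) - 1) (2 * order (α j) - 1) := by
    intro j
    have hj := hα j
    refine Submodule.add_mem _ (hG j) (Submodule.add_mem _ (Submodule.sum_mem _ fun i _ => ?_) ?_)
    · exact mem_jetLE_of_le (mul_mem_jetLE (X_mem_jetLE (a := 1) (by simp) (by simp; omega)
        (by simp; omega) (by simp)) (formPoly_mem_jetLE h (S j) _ (hS j))) le_rfl (by omega)
        (by omega)
    · exact mem_jetLE_of_le (mul_mem_jetLE (X_mem_jetLE (a := 0) (by simp) (by simp; omega)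
        (by simp; omega) (by simp)) (formPoly_mem_jetLE h (S j) _ (hS j))) le_rfl (by omega)
        (by omega)
  let F : Fin (m + 1) → JetPoly n := fun j => MvPolynomial.X (0, 1) ^ (2 * order (α j) - 2) *
    MvPolynomial.X (α j, 0)
  have hcomb : ∀ i (c : Fin (m + 1) → ℂ),
      (∀ b, ∑ j, c j * MvPolynomial.eval (x i) (u j b) = 0) →
      ∑ j, c j * MvPolynomial.eval (x i) (g j - F j) = 0 := by
    intro i c hc
    set y : E := ∑ j, c j • vectorValue (x i) h (S j) with hy
    have hform : ∀ φ : E →ₗ[ℂ] ℂ, ∑ j, c j * MvPolynomial.eval (x i) (formPoly h (S j) φ) = φ y := by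
      intro φ
      simp [hy, eval_formPoly]
    have hπy : π y = 0 := by
      ext b
      have := hform (LinearMap.proj b ∘ₗ π)
      rw [hc b] at this
      simpa using this.symm
    obtain ⟨p, hp⟩ : y ∈ LinearMap.range T := by rw [← hπ]; exact hπy
    have hΛy : Λ y = p := by rw [← hp]; exact LinearMap.congr_fun hΛ p
    have h1 := hνT i p
    have h2 : x i (0, 1) * ν i y + (∑ j, c j * MvPolynomial.eval (x i) (G j - F j)) *
        ν i (T wUnit) = 0 := by
      have : ∑ j, c j * (x i (0, 1) * ν i (vectorValue (x i) h (S j)) +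
          MvPolynomial.eval (x i) (G j - F j) * ν i (T wUnit)) = 0 :=
        Finset.sum_eq_zero fun j _ => by rw [hrel i j, mul_zero]
      rw [← this, hy, map_sum, Finset.mul_sum, Finset.sum_mul, ← Finset.sum_add_distrib]
      refine Finset.sum_congr rfl fun j _ => ?_
      rw [map_smul, smul_eq_mul]
      ring
    rw [hp] at h1
    rw [h1, ← add_mul] at h2
    have h3 := (mul_eq_zero.1 h2).resolve_right (hν i)
    have h4 : ∀ j, MvPolynomial.eval (x i) (g j - F j) = MvPolynomial.eval (x i) (G j - F j) +
        (∑ q, x i (Pi.single q 1, 0) * MvPolynomial.eval (x i)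
          (formPoly h (S j) (LinearMap.proj q ∘ₗ LinearMap.fst ℂ _ _ ∘ₗ Λ)) +
          x i (0, 1) * MvPolynomial.eval (x i)
            (formPoly h (S j) (LinearMap.snd ℂ _ _ ∘ₗ Λ))) := by
      intro j
      simp only [g, map_sub, map_add, map_sum, map_mul, MvPolynomial.eval_X]
      ring
    rw [← h3]
    -- After cancellation of ν(T ∂_w) neither ν nor H appears except through constant coefficients;
    -- it remains to match the components of Λ y with those of p.
    simp only [h4, mul_add, Finset.sum_add_distrib]
    rw [add_comm]
    congr 1
    congr 1
    · simp only [Finset.mul_sum]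
      rw [Finset.sum_comm]
      refine Finset.sum_congr rfl fun q _ => ?_
      have := hform (LinearMap.proj q ∘ₗ LinearMap.fst ℂ _ _ ∘ₗ Λ)
      simp only [LinearMap.comp_apply, hΛy, LinearMap.fst_apply, LinearMap.proj_apply] at this
      rw [← this, Finset.mul_sum]
      exact Finset.sum_congr rfl fun j _ => by ring
    · have := hform (LinearMap.snd ℂ _ _ ∘ₗ Λ)
      simp only [LinearMap.comp_apply, hΛy, LinearMap.snd_apply] at this
      rw [← this, Finset.mul_sum]
      exact Finset.sum_congr rfl fun j _ => by ring
  obtain ⟨I, j₀, hj₀, hI, ⟨i₁, hi₁⟩, hdep⟩ := exists_minimal_dependent (fun j => order (α j))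
    (fun i j b => MvPolynomial.eval (x i) (u j b)) (fun i hli => by
      have := (linearIndepOn_univ_iff.1 hli).fintype_card_le_finrank
      simp at this)
  set k := order (α j₀) with hk
  set l := (Finset.univ.filter (fun j => order (α j) ≤ k)).card with hl
  set r := I.card with hr
  have hrl : r + 1 ≤ l := by
    rw [← Finset.card_insert_of_notMem hj₀]
    refine Finset.card_le_card fun j hj => ?_
    rw [Finset.mem_filter]
    refine ⟨Finset.mem_univ _, ?_⟩
    rcases Finset.mem_insert.1 hj with rfl | hj
    exacts [le_rfl, hI j hj]
  let e : Fin r → Fin (m + 1) := fun p => I.equivFin.symm p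
  have heI : ∀ p, e p ∈ I := fun p => (I.equivFin.symm p).2
  have heinj : Function.Injective e := Subtype.val_injective.comp I.equivFin.symm.injective
  have hrange : range e = (I : Set (Fin (m + 1))) := by
    ext j
    refine ⟨fun ⟨p, hp⟩ => hp ▸ heI p, fun hj => ⟨I.equivFin ⟨j, hj⟩, ?_⟩⟩
    simp [e]
  let row : Fin (r + 1) → Fin (m + 1) := Fin.cons j₀ e
  have hrowinj : Function.Injective row :=
    Fin.cons_injective_iff.2 ⟨fun ⟨p, hp⟩ => hj₀ (hp ▸ heI p), heinj⟩
  have hrowrange : range row = ((insert j₀ I : Finset (Fin (m + 1))) : Set (Fin (m + 1))) := by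
    rw [Fin.range_cons, hrange, Finset.coe_insert]
  have hrowk : ∀ p, order (α (row p)) ≤ k := by
    intro p
    refine Fin.cases le_rfl (fun p => ?_) p
    exact hI _ (heI p)
  have hk2 : 2 ≤ k := hα j₀
  obtain ⟨c, hc, hc0, hcu⟩ := exists_minor_relation (k := k) (a := 2 * k - 2) (d := 2 * k - 2) x
    (fun p => u (row p)) (fun p b => mem_jetLE_of_le (formPoly_mem_jetLE h _ _ (hS (row p)))
      (hrowk p) (by have := hrowk p; omega) (by have := hrowk p; omega)) i₁
    (by rw [← hrange, linearIndepOn_range_iff heinj] at hi₁; exact hi₁)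
    (fun i hli => hdep i (by
      rw [← hrowrange, linearIndepOn_range_iff hrowinj]
      exact hli))
  -- The minors, extended by zero to the multiindices outside the chosen family.
  let cc : Fin (m + 1) → JetPoly n := fun j => ∑ p, if row p = j then c p else 0
  have hcc : ∀ j, cc j ∈ jetLE n k (r * (2 * k - 2)) (r * (2 * k - 2)) := fun j =>
    Submodule.sum_mem _ fun p _ => by
      split_ifs
      exacts [hc p, Submodule.zero_mem _]
  have hccrow : ∀ p, cc (row p) = c p := by
    intro p
    simp [cc, hrowinj.eq_iff]
  have hcc0 : ∀ j, k < order (α j) → cc j = 0 := fun j hj => Finset.sum_eq_zero fun p _ =>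
    if_neg fun h => absurd (hrowk p) (by rw [h]; omega)
  have hccsum : ∀ i (y : Fin (m + 1) → ℂ), ∑ j, MvPolynomial.eval (x i) (cc j) * y j =
      ∑ p, MvPolynomial.eval (x i) (c p) * y (row p) := by
    intro i y
    simp only [cc, map_sum, Finset.sum_mul]
    rw [Finset.sum_comm]
    refine Finset.sum_congr rfl fun p _ => ?_
    rw [Finset.sum_eq_single (row p)]
    · simp
    · intro j _ hj
      simp [Ne.symm hj]
    · simp
  have hmain : ∀ i, ∑ j, MvPolynomial.eval (x i) (cc j) * MvPolynomial.eval (x i) (g j - F j) = 0 :=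
    fun i => hcomb i _ fun b => by
      rw [hccsum i fun j => MvPolynomial.eval (x i) (u j b)]
      exact hcu i b
  have hbound : (2 * k - 2) * (r + 1) ≤ (2 * k - 2) * l := Nat.mul_le_mul_left _ hrl
  have hbound' : r * (2 * k - 2) ≤ (2 * k - 2) * (l - 1) := by
    rw [mul_comm]
    exact Nat.mul_le_mul_left _ (by omega)
  rw [mul_add, mul_one, mul_comm _ r] at hbound
  -- The terms with |α j| = k go to the left and the rest to R. The r-fold minors have weight and
  -- degree at most r(2k-2) with r ≤ l - 1. The factor ρ_w^(2k-2) has weight 0 and so costs only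
  -- degree, while in R the remaining factor adds at most 2k-1 to both.
  refine ⟨k, l, ⟨j₀, rfl⟩, rfl, fun j => cc j * MvPolynomial.X (0, 1) ^ (2 * k - 2),
    ∑ j, cc j * (g j - if order (α j) = k then 0 else F j), fun i => ?_, ⟨j₀, rfl, i₁, ?_⟩,
    fun j => ?_, Submodule.sum_mem _ fun j _ => ?_⟩
  · rw [map_sum, Finset.sum_filter, ← sub_eq_zero, ← neg_eq_zero, neg_sub]
    refine Eq.trans ?_ (hmain i)
    rw [← Finset.sum_sub_distrib]
    refine Finset.sum_congr rfl fun j _ => ?_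
    split_ifs with hjk
    · simp only [map_mul, map_sub, map_pow, MvPolynomial.eval_X, map_zero, F, hjk]
      ring
    · simp only [map_mul, map_sub]
      ring
  · rw [map_mul, map_pow, MvPolynomial.eval_X]
    have : cc j₀ = c 0 := hccrow 0
    rw [this]
    exact mul_ne_zero hc0 (pow_ne_zero _ (hx i₁))
  · have hw : (MvPolynomial.X (0, 1) : JetPoly n) ∈ jetLE n k 0 1 :=
      X_mem_jetLE (by simp) (by simp; omega) (by simp; omega) (by simp)
    exact mem_jetLE_of_le (mul_mem_jetLE (hcc j) (pow_mem_jetLE hw (2 * k - 2))) le_rfl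
      (by omega) (by omega)
  · rcases lt_or_ge k (order (α j)) with hjk | hjk
    · rw [hcc0 j hjk, zero_mul]
      exact Submodule.zero_mem _
    · have hgF : g j - (if order (α j) = k then 0 else F j) ∈
          jetLE n k (2 * k - 1) (2 * k - 1) := by
        refine Submodule.sub_mem _ (mem_jetLE_of_le (hg j) hjk (by omega) (by omega)) ?_
        split_ifs with hjk'
        · exact Submodule.zero_mem _
        · have hw : (MvPolynomial.X (0, 1) : JetPoly n) ∈ jetLE n k 0 1 :=
            X_mem_jetLE (by simp) (by simp; omega) (by simp; omega) (by simp)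
          have hX : (MvPolynomial.X (α j, 0) : JetPoly n) ∈ jetLE n k (2 * order (α j) - 1) 1 :=
            X_mem_jetLE (by have := hα j; omega) (by omega) (by omega) (by omega)
          exact mem_jetLE_of_le (mul_mem_jetLE (pow_mem_jetLE hw _) hX) le_rfl (by omega)
            (by omega)
      exact mem_jetLE_of_le (mul_mem_jetLE (hcc j) hgF) le_rfl (by omega) (by omega)

end PolynomialRelation

/-! ### The hyperquadric and its complex differential. -/

section Quadric

variable {N : ℕ} (L : (Fin (N + 1) → ℂ) ≃L[ℂ] (Fin N → ℂ) × ℂ) (A : Matrix (Fin N) (Fin N) ℂ)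

/-- The complex differential, up to the factor `2`, of the defining function of a hyperquadric, as a
function of the conjugate coordinates `a` of the base point. -/
noncomputable def polarForm (a : Fin N → ℂ) : (Fin (N + 1) → ℂ) →ₗ[ℂ] ℂ :=
  ((2 * Complex.I)⁻¹ • LinearMap.snd ℂ (Fin N → ℂ) ℂ -
    ∑ i, ∑ j, (a i * A i j) • (LinearMap.proj j ∘ₗ LinearMap.fst ℂ (Fin N → ℂ) ℂ)) ∘ₗ
      (L.toLinearEquiv : (Fin (N + 1) → ℂ) →ₗ[ℂ] (Fin N → ℂ) × ℂ)

lemma polarForm_apply (a : Fin N → ℂ) (v : Fin (N + 1) → ℂ) :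
    polarForm L A a v = (2 * Complex.I)⁻¹ * (L v).2 - ∑ i, ∑ j, a i * A i j * (L v).1 j := by
  simp [polarForm]

variable {A} in
lemma star_sum_hermitian (hA : A.IsHermitian) (a b : Fin N → ℂ) :
    star (∑ i, ∑ j, star (a i) * A i j * b j) = ∑ i, ∑ j, star (b i) * A i j * a j := by
  simp only [star_sum, star_mul', star_star]
  rw [Finset.sum_comm]
  refine Finset.sum_congr rfl fun j _ => Finset.sum_congr rfl fun i _ => ?_
  rw [hA.apply]
  ring

lemma inv_two_I_mul_sub_star (w : ℂ) :
    (2 * Complex.I)⁻¹ * w - (2 * Complex.I)⁻¹ * star w = (w.im : ℂ) := by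
  have h : w - star w = 2 * Complex.I * w.im := by
    have := Complex.sub_conj w
    rw [Complex.star_def, this]
    push_cast
    ring
  rw [← mul_sub, h, ← mul_assoc, inv_mul_cancel₀ (by simp), one_mul]

variable {A} in
lemma ofReal_quadricFn (hA : A.IsHermitian) (Z : Fin (N + 1) → ℂ) :
    (quadricFn L A Z : ℂ) =
      polarForm L A (star (L Z).1) Z - (2 * Complex.I)⁻¹ * star (L Z).2 := by
  have h := Complex.conj_eq_iff_re.1 (star_sum_hermitian hA (L Z).1 (L Z).1)
  rw [quadricFn, polarForm_apply, Complex.ofReal_sub, h, ← inv_two_I_mul_sub_star]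
  simp only [Pi.star_apply]
  ring

lemma differentiable_quadricFn : Differentiable ℝ (quadricFn L A) := by
  have hL : Differentiable ℝ L := (L.differentiable).restrictScalars ℝ
  have h1 : ∀ i, Differentiable ℝ fun Z => (L Z).1 i := fun i => by fun_prop
  have h2 : Differentiable ℝ fun Z => (L Z).2 := by fun_prop
  refine Differentiable.sub (Complex.imCLM.differentiable.comp h2)
    (Complex.reCLM.differentiable.comp (Differentiable.fun_sum fun i _ =>
      Differentiable.fun_sum fun j _ => ?_))
  exact ((h1 i).star.mul_const _).mul (h1 j)

variable {A} in
lemma fderiv_quadricFn (hA : A.IsHermitian) (p v : Fin (N + 1) → ℂ) :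
    fderiv ℝ (quadricFn L A) p v = 2 * (polarForm L A (star (L p).1) v).re := by
  set s : (Fin N → ℂ) → (Fin N → ℂ) → ℂ := fun a b => ∑ i, ∑ j, star (a i) * A i j * b j with hs
  have hline : HasDerivAt (fun t : ℝ => p + t • v) v 0 := by
    simpa using ((hasDerivAt_id (0 : ℝ)).smul_const v).const_add p
  have h1 : HasDerivAt (fun t : ℝ => quadricFn L A (p + t • v)) (fderiv ℝ (quadricFn L A) p v) 0 := by
    have h : HasFDerivAt (quadricFn L A) (fderiv ℝ (quadricFn L A) p) (p + (0 : ℝ) • v) := by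
      simpa using (differentiable_quadricFn L A p).hasFDerivAt
    exact h.comp_hasDerivAt (0 : ℝ) hline
  have hLt : ∀ t : ℝ, L (p + t • v) = L p + (t : ℂ) • L v := fun t => by
    rw [map_add, ← Complex.coe_smul, map_smul]
  -- Along a real line the function is a quadratic polynomial in t; the hermitian symmetry merges
  -- the two mixed terms into twice a real part.
  have h2 : ∀ t : ℝ, quadricFn L A (p + t • v) =
      quadricFn L A p + t * (2 * (polarForm L A (star (L p).1) v).re) +
        t ^ 2 * (-(s (L v).1 (L v).1).re) := by
    intro t
    have hexp : s (L p + (t : ℂ) • L v).1 (L p + (t : ℂ) • L v).1 = s (L p).1 (L p).1 +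
        t * (s (L p).1 (L v).1 + s (L v).1 (L p).1) + t ^ 2 * s (L v).1 (L v).1 := by
      simp only [hs, Finset.mul_sum, ← Finset.sum_add_distrib, mul_add]
      refine Finset.sum_congr rfl fun i _ => Finset.sum_congr rfl fun j _ => ?_
      simp only [Prod.fst_add, Prod.smul_fst, Pi.add_apply, Pi.smul_apply, smul_eq_mul, star_add,
        star_mul', Complex.star_def, Complex.conj_ofReal]
      ring
    have hconj : (s (L v).1 (L p).1).re = (s (L p).1 (L v).1).re := by
      have h : star (s (L p).1 (L v).1) = s (L v).1 (L p).1 :=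
        star_sum_hermitian hA (L p).1 (L v).1
      rw [← h, Complex.star_def, Complex.conj_re]
    have hq : ∀ Z, quadricFn L A Z = (L Z).2.im - (s (L Z).1 (L Z).1).re := fun _ => rfl
    have hpol : polarForm L A (star (L p).1) v =
        (2 * Complex.I)⁻¹ * (L v).2 - s (L p).1 (L v).1 := polarForm_apply ..
    have him : ((2 * Complex.I)⁻¹ * (L v).2).re = (L v).2.im / 2 := by
      rw [mul_inv, Complex.inv_I]
      simp [Complex.mul_re]
      ring
    rw [hq, hq, hLt, hexp, hpol, Complex.sub_re, him]
    have e1 : ∀ z : ℂ, ((t : ℂ) * z).re = t * z.re := fun z => Complex.re_ofReal_mul t z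
    have e2 : ∀ z : ℂ, ((t : ℂ) ^ 2 * z).re = t ^ 2 * z.re := fun z => by
      rw [← Complex.ofReal_pow, Complex.re_ofReal_mul]
    have e3 : (L p + (t : ℂ) • L v).2.im = (L p).2.im + t * (L v).2.im := by simp
    rw [e3, Complex.add_re, Complex.add_re, e1, e2, Complex.add_re, hconj]
    ring
  have h3 : HasDerivAt (fun t : ℝ => quadricFn L A (p + t • v))
      (2 * (polarForm L A (star (L p).1) v).re) 0 := by
    have := ((((hasDerivAt_id (0 : ℝ)).mul_const
      (2 * (polarForm L A (star (L p).1) v).re)).const_add (quadricFn L A p))).add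
      (((hasDerivAt_id (0 : ℝ)).pow 2).mul_const (-(s (L v).1 (L v).1).re))
    refine (this.congr_of_eventuallyEq (Eventually.of_forall fun t => ?_)).congr_deriv ?_
    · rw [h2]; rfl
    · simp
  exact h1.unique h3

variable {A} in
/-- A transversal linear map is not annihilated by the complex differential of the hyperquadric. -/
lemma exists_polarForm_ne_zero (hA : A.IsHermitian) (p : Fin (N + 1) → ℂ) {V : Type*}
    [AddCommGroup V] [Module ℝ V] (T : V →ₗ[ℝ] (Fin (N + 1) → ℂ))
    (hT : LinearMap.range T ⊔ hyperquadricTangent L A p = ⊤) :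
    ∃ v, polarForm L A (star (L p).1) (T v) ≠ 0 := by
  by_contra! hcon
  have h1 : LinearMap.range T ≤ hyperquadricTangent L A p := by
    rintro _ ⟨v, rfl⟩
    rw [hyperquadricTangent, LinearMap.mem_ker]
    change fderiv ℝ (quadricFn L A) p (T v) = 0
    rw [fderiv_quadricFn L hA, hcon]
    simp
  rw [sup_eq_right.2 h1] at hT
  -- The derivative in the direction of Im w is 1, so the tangent space cannot be everything.
  have h2 : L.symm (0, Complex.I) ∈ hyperquadricTangent L A p := hT ▸ Submodule.mem_top
  rw [hyperquadricTangent, LinearMap.mem_ker] at h2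
  change fderiv ℝ (quadricFn L A) p (L.symm (0, Complex.I)) = 0 at h2
  rw [fderiv_quadricFn L hA, polarForm_apply] at h2
  have h3 : (2 * Complex.I)⁻¹ * Complex.I = ((2⁻¹ : ℝ) : ℂ) := by
    rw [mul_inv, mul_assoc, inv_mul_cancel₀ Complex.I_ne_zero]
    simp
  simp only [ContinuousLinearEquiv.apply_symm_apply, Pi.zero_apply, mul_zero,
    Finset.sum_const_zero, sub_zero, h3, Complex.ofReal_re] at h2
  norm_num at h2

end Quadric

/-! ### Antiholomorphic dependence on the point ζ. -/

section Evaluation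

variable {n : ℕ}

lemma isOpen_prod_star {U : Set (Cz n)} (hU : IsOpen U) : IsOpen (U ×ˢ {χ : Cz n | star χ ∈ U}) :=
  hU.prod (hU.preimage continuous_star)

/-- The polynomials in the derivatives `ρ_{z^β w^s}(0, ζ̄)` are antiholomorphic in `ζ`. -/
lemma differentiableOn_star_evalAt {U : Set (Cz n)} (hU : IsOpen U) (h0 : (0 : Cz n) ∈ U)
    {ρ : Cz n → Cz n → ℂ} (hρ : IsComplexifiedRealAnalytic U ρ) (P : JetPoly n) :
    DifferentiableOn ℂ (fun ζ => star (P.evalAt ρ ζ)) U := by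
  have hv : ∀ v : (Fin n → ℕ) × ℕ, DifferentiableOn ℂ
      (fun ζ => star (mixedPartial v.1 v.2 (fun Z => ρ Z (star ζ)) 0)) U := by
    intro v ζ hζ
    have h1 := differentiableOn_mixedPartial_param (isOpen_prod_star hU) hρ.holo v.1 v.2 0
    have hO : IsOpen {y : Cz n | ((0 : Cz n), y) ∈ U ×ˢ {χ : Cz n | star χ ∈ U}} :=
      (isOpen_prod_star hU).preimage (by fun_prop)
    have h2 := (h1.differentiableAt (x := star ζ)
      (hO.mem_nhds ⟨h0, by simpa using hζ⟩)).star_star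
    rw [star_star] at h2
    exact h2.differentiableWithinAt
  induction P using MvPolynomial.induction_on with
  | C r => simp [JetPoly.evalAt]
  | add P Q hP hQ =>
    refine (hP.add hQ).congr fun ζ _ => ?_
    simp [JetPoly.evalAt]
  | mul_X P v hP =>
    refine (hP.mul (hv v)).congr fun ζ _ => ?_
    simp [JetPoly.evalAt]

end Evaluation

/-! ### Pullback of the quadric and the relation near the origin. -/

section Embedding

variable {n N : ℕ} (L : (Fin (N + 1) → ℂ) ≃L[ℂ] (Fin N → ℂ) × ℂ) (A : Matrix (Fin N) (Fin N) ℂ)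

/-- The complexification of the defining function of a hyperquadric, pulled back by `H`. -/
noncomputable def quadricPullback (H : Cz n → (Fin (N + 1) → ℂ)) (p : Cz n × Cz n) : ℂ :=
  polarForm L A (star (L (H (star p.2))).1) (H p.1) -
    (2 * Complex.I)⁻¹ * star (L (H (star p.2))).2

lemma differentiableOn_star_comp {r : ℝ} {φ : Cz n → ℂ} (hφ : DifferentiableOn ℂ φ (ball 0 r)) :
    DifferentiableOn ℂ (fun χ => star (φ (star χ))) (ball 0 r) := by
  intro χ hχ
  have h := ((hφ.differentiableAt
    (isOpen_ball.mem_nhds (star_mem_ball_iff.2 hχ)))).star_star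
  rw [star_star] at h
  exact h.differentiableWithinAt

lemma differentiableOn_quadricPullback {r : ℝ} {H : Cz n → (Fin (N + 1) → ℂ)}
    (hH : DifferentiableOn ℂ H (ball 0 r)) :
    DifferentiableOn ℂ (quadricPullback L A H) (ball 0 r ×ˢ ball 0 r) := by
  have hz : ∀ j, DifferentiableOn ℂ (fun Z => (L (H Z)).1 j) (ball 0 r) := fun j => by fun_prop
  have hw : DifferentiableOn ℂ (fun Z => (L (H Z)).2) (ball 0 r) := by fun_prop
  have hfst : MapsTo (Prod.fst : Cz n × Cz n → Cz n) (ball 0 r ×ˢ ball 0 r) (ball 0 r) :=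
    fun p hp => hp.1
  have hsnd : MapsTo (Prod.snd : Cz n × Cz n → Cz n) (ball 0 r ×ˢ ball 0 r) (ball 0 r) :=
    fun p hp => hp.2
  have h1 : ∀ j, DifferentiableOn ℂ (fun p : Cz n × Cz n => (L (H p.1)).1 j)
      (ball 0 r ×ˢ ball 0 r) := fun j => (hz j).comp differentiableOn_fst hfst
  have h2 : DifferentiableOn ℂ (fun p : Cz n × Cz n => (L (H p.1)).2)
      (ball 0 r ×ˢ ball 0 r) := hw.comp differentiableOn_fst hfst
  have h3 : ∀ j, DifferentiableOn ℂ (fun p : Cz n × Cz n => star ((L (H (star p.2))).1 j))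
      (ball 0 r ×ˢ ball 0 r) := fun j =>
    (differentiableOn_star_comp (hz j)).comp differentiableOn_snd hsnd
  have h4 : DifferentiableOn ℂ (fun p : Cz n × Cz n => star (L (H (star p.2))).2)
      (ball 0 r ×ˢ ball 0 r) :=
    (differentiableOn_star_comp hw).comp differentiableOn_snd hsnd
  have : quadricPullback L A H = fun p : Cz n × Cz n => (2 * Complex.I)⁻¹ * (L (H p.1)).2 -
      ∑ i, ∑ j, star ((L (H (star p.2))).1 i) * A i j * (L (H p.1)).1 j -
      (2 * Complex.I)⁻¹ * star (L (H (star p.2))).2 := by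
    ext p
    rw [quadricPullback, polarForm_apply]
    rfl
  rw [this]
  refine ((h2.const_mul _).sub (DifferentiableOn.fun_sum fun i _ =>
    DifferentiableOn.fun_sum fun j _ => ?_)).sub (h4.const_mul _)
  exact ((h3 i).mul_const _).mul (h1 j)

lemma continuousAt_polarForm {r : ℝ} (hr : 0 < r) {H : Cz n → (Fin (N + 1) → ℂ)}
    (hH : DifferentiableOn ℂ H (ball 0 r)) (v : Fin (N + 1) → ℂ) :
    ContinuousAt (fun χ => polarForm L A (star (L (H (star χ))).1) v) 0 := by
  simp only [polarForm_apply, Pi.star_apply]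
  have h3 : ∀ i, ContinuousAt (fun χ : Cz n => star ((L (H (star χ))).1 i)) 0 := fun i =>
    ((differentiableOn_star_comp (r := r) (φ := fun Z => (L (H Z)).1 i)
      (by fun_prop)).differentiableAt (ball_mem_nhds 0 hr)).continuousAt
  fun_prop

/-- The vectors of the derivatives of the components of a map. -/
noncomputable def jetVector (H : Cz n → (Fin (N + 1) → ℂ)) (v : (Fin n → ℕ) × ℕ) :
    Fin (N + 1) → ℂ :=
  fun q => mixedPartial v.1 v.2 (fun Z => H Z q) 0

/-- Derivatives of positive order kill b and commute with φ. With φ = ν_χ all dependence on χ sits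
in φ, and the jet vector of H is fixed; this makes the linear algebra have constant vectors. -/
lemma mixedPartial_form {r : ℝ} (hr : 0 < r) {H : Cz n → (Fin (N + 1) → ℂ)}
    (hH : DifferentiableOn ℂ H (ball 0 r)) (φ : (Fin (N + 1) → ℂ) →ₗ[ℂ] ℂ) (b : ℂ)
    {v : (Fin n → ℕ) × ℕ} (hv : 0 < order v.1 + v.2) :
    mixedPartial v.1 v.2 (fun Z => φ (H Z) - b) 0 = φ (jetVector H v) := by
  have h : ∀ y : Fin (N + 1) → ℂ, φ y = ∑ q, φ (Pi.single q 1) * y q := fun y => by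
    rw [LinearMap.pi_apply_eq_sum_univ φ y]
    refine Finset.sum_congr rfl fun q _ => ?_
    rw [smul_eq_mul, mul_comm]
    congr 2
    ext i
    simp [Pi.single_apply, eq_comm]
  have h1 : (fun Z => φ (H Z) - b) =
      fun Z => ∑ q, φ (Pi.single q 1) * (fun q Z => H Z q) q Z + -b := by
    ext Z
    rw [h, sub_eq_add_neg]
  rw [h1, mixedPartial_sum_add_const isOpen_ball Finset.univ _ _
    (fun q _ => (differentiableOn_pi.1 hH q)) _ hv (mem_ball_self hr), h (jetVector H v)]
  rfl

/-- The relation on the part near `0` of the Segre variety of `0`. -/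
lemma exists_relation_near_zero {m : ℕ} {U : Set (Cz n)} (hU : IsOpen U) (h0 : (0 : Cz n) ∈ U)
    {ρ : Cz n → Cz n → ℂ} (hρ : IsComplexifiedRealAnalytic U ρ) (hρ0 : ρ 0 0 = 0)
    (hρw : mixedPartial 0 1 (fun Z => ρ Z 0) 0 ≠ 0)
    (hemb : TransversallyEmbeddable (hypersurface U ρ) (n + m))
    (α : Fin (m + 1) → Fin n → ℕ) (hα : ∀ j, 2 ≤ order (α j)) :
    ∃ ε > 0, ∃ k l : ℕ,
      (∃ j, order (α j) = k) ∧
      l = (Finset.univ.filter (fun j => order (α j) ≤ k)).card ∧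
      ∃ (P : Fin (m + 1) → JetPoly n) (R : JetPoly n),
        (∀ ζ ∈ segreVariety U ρ 0 ∩ ball 0 ε,
          ∑ j ∈ Finset.univ.filter (fun j => order (α j) = k),
            (P j).evalAt ρ ζ * mixedPartial (α j) 0 (fun Z => ρ Z (star ζ)) 0 = R.evalAt ρ ζ) ∧
        (∃ j, order (α j) = k ∧ ∃ ζ ∈ segreVariety U ρ 0, (P j).evalAt ρ ζ ≠ 0) ∧
        (∀ j, P j ∈ jetLE n k ((2 * k - 2) * (l - 1)) ((2 * k - 2) * l)) ∧
        R ∈ jetLE n k ((2 * k - 2) * l + 1) ((2 * k - 2) * l + 1) := by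
  obtain ⟨L, A, hA, Ω, H, hΩ, hMΩ, hH, hmaps, htrans⟩ := hemb
  have h0M : (0 : Cz n) ∈ hypersurface U ρ := ⟨h0, by rw [star_zero]; exact hρ0⟩
  obtain ⟨r, hr, hrU⟩ := Metric.isOpen_iff.1 (hU.inter hΩ) 0 ⟨h0, hMΩ h0M⟩
  have hHd : DifferentiableOn ℂ H (ball 0 r) := hH.holo.mono (hrU.trans inter_subset_right)
  let g : Cz n × Cz n → ℂ := fun p => ρ p.1 p.2
  have hgd : DifferentiableOn ℂ g (ball 0 r ×ˢ ball 0 r) := hρ.holo.mono fun p hp =>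
    ⟨(hrU hp.1).1, (hrU (star_mem_ball_iff.2 hp.2)).1⟩
  have hBo : IsOpen (ball (0 : Cz n) r ×ˢ ball (0 : Cz n) r) := isOpen_ball.prod isOpen_ball
  have h00 : ((0 : Cz n), (0 : Cz n)) ∈ ball (0 : Cz n) r ×ˢ ball (0 : Cz n) r :=
    ⟨mem_ball_self hr, mem_ball_self hr⟩
  have hreal : ∀ Z ∈ ball (0 : Cz n) r, (g (Z, star Z)).im = 0 := fun Z hZ =>
    hρ.real Z (hrU hZ).1
  have hgw_eq : ∀ p ∈ ball (0 : Cz n) r ×ˢ ball (0 : Cz n) r,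
      dirDeriv wUnit (fun Z => ρ Z p.2) p.1 = dirDeriv (wUnit, (0 : Cz n)) g p := fun p hp =>
    iterDeriv_prod hBo hgd [wUnit] hp
  have hgw : dirDeriv (wUnit, (0 : Cz n)) g (0, 0) ≠ 0 := by
    rw [← hgw_eq _ h00, ← mixedPartial_zero_one]
    exact hρw
  obtain ⟨δ, hδ, hQ⟩ := exists_eq_zero_of_eq_zero_on_hypersurface hr hgd
    (differentiableOn_quadricPullback L A hHd) hreal hρ0 hgw fun Z hZ hgZ => by
      have h1 : quadricFn L A (H Z) = 0 := hmaps ⟨(hrU hZ).1, hgZ⟩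
      have h2 := ofReal_quadricFn L hA (H Z)
      rw [h1, Complex.ofReal_zero] at h2
      rw [quadricPullback, star_star, ← h2]
  set T : Cz n →L[ℂ] (Fin (n + m + 1) → ℂ) := fderiv ℂ H 0 with hTdef
  have hHT : HasFDerivAt H T 0 := (hHd.differentiableAt (ball_mem_nhds 0 hr)).hasFDerivAt
  have hTinj : Function.Injective T := hH.immersion 0 (hMΩ h0M)
  let ν : Cz n → (Fin (n + m + 1) → ℂ) →ₗ[ℂ] ℂ := fun χ => polarForm L A (star (L (H (star χ))).1)
  have hslice : ∀ χ ∈ ball (0 : Cz n) r, DifferentiableOn ℂ (fun Z => ρ Z χ) (ball 0 r) :=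
    fun χ hχ => hgd.comp (f := fun Z => (Z, χ)) (by fun_prop) fun Z hZ => ⟨hZ, hχ⟩
  have hslice' : ∀ χ ∈ ball (0 : Cz n) r,
      DifferentiableOn ℂ (fun Z => quadricPullback L A H (Z, χ)) (ball 0 r) :=
    fun χ hχ => (differentiableOn_quadricPullback L A hHd).comp (f := fun Z => (Z, χ))
      (by fun_prop) fun Z hZ => ⟨hZ, hχ⟩
  have hF' : ∀ χ, HasFDerivAt (fun Z => quadricPullback L A H (Z, χ))
      ((ν χ).toContinuousLinearMap.comp T) 0 := fun χ =>
    ((ν χ).toContinuousLinearMap.hasFDerivAt.comp 0 hHT).sub_const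
      ((2 * Complex.I)⁻¹ * star (L (H (star χ))).2)
  have htan : ∀ χ ∈ ball (0 : Cz n) (min r δ), ρ 0 χ = 0 → dirDeriv wUnit (fun Z => ρ Z χ) 0 ≠ 0 →
      ∀ p : Cz n, dirDeriv wUnit (fun Z => ρ Z χ) 0 * ν χ (T p) =
        fderiv ℂ (fun Z => ρ Z χ) 0 p * ν χ (T wUnit) := by
    intro χ hχ hρχ hw p
    have hsub : ball (0 : Cz n) (min r δ) ⊆ ball 0 r := ball_subset_ball (min_le_left _ _)
    have hsub' : ball (0 : Cz n) (min r δ) ⊆ ball 0 δ := ball_subset_ball (min_le_right _ _)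
    have := fderiv_mul_sub_eq_zero isOpen_ball ((hslice χ (hsub hχ)).mono hsub)
      ((hslice' χ (hsub hχ)).mono hsub) (fun Z hZ h => hQ Z (hsub' hZ) χ (hsub' hχ) h)
      (u := p) (v := wUnit) (mem_ball_self (lt_min hr hδ)) hρχ hw
    rw [(hF' χ).fderiv] at this
    exact sub_eq_zero.1 this
  -- By tangency, vanishing on T ∂_w would make ν_0 vanish on the whole image of T, against
  -- transversality at 0.
  have hν0 : ν 0 (T wUnit) ≠ 0 := by
    intro hcon
    obtain ⟨v, hv⟩ := exists_polarForm_ne_zero L hA (H 0) _ (htrans 0 h0M)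
    have hw0 : dirDeriv wUnit (fun Z => ρ Z 0) 0 ≠ 0 := by
      rw [← mixedPartial_zero_one]; exact hρw
    have := htan 0 (mem_ball_self (lt_min hr hδ)) hρ0 hw0 v
    rw [hcon, mul_zero] at this
    refine hv ?_
    have := (mul_eq_zero.1 this).resolve_left hw0
    simp only [ν, star_zero] at this
    exact this
  obtain ⟨ε₁, hε₁, hw₁⟩ := Metric.eventually_nhds_iff_ball.1
    (((differentiableOn_dirDeriv hBo hgd (wUnit, (0 : Cz n))).differentiableAt
      (hBo.mem_nhds h00)).continuousAt.eventually_ne hgw)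
  obtain ⟨ε₂, hε₂, hν₂⟩ := Metric.eventually_nhds_iff_ball.1
    ((continuousAt_polarForm L A hr hHd (T wUnit)).eventually_ne hν0)
  rw [← ball_prod_same] at hw₁
  set ε := min (min r δ) (min ε₁ ε₂) with hε
  have hεpos : 0 < ε := lt_min (lt_min hr hδ) (lt_min hε₁ hε₂)
  have hεr : ball (0 : Cz n) ε ⊆ ball 0 r :=
    ball_subset_ball ((min_le_left _ _).trans (min_le_left _ _))
  have hεδ : ball (0 : Cz n) ε ⊆ ball 0 δ :=
    ball_subset_ball ((min_le_left _ _).trans (min_le_right _ _))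
  have hεrδ : ball (0 : Cz n) ε ⊆ ball 0 (min r δ) := ball_subset_ball (min_le_left _ _)
  have hεε₁ : ball (0 : Cz n) ε ⊆ ball 0 ε₁ :=
    ball_subset_ball ((min_le_right _ _).trans (min_le_left _ _))
  have hεε₂ : ball (0 : Cz n) ε ⊆ ball 0 ε₂ :=
    ball_subset_ball ((min_le_right _ _).trans (min_le_right _ _))
  have hfw : ∀ χ ∈ ball (0 : Cz n) ε, ∀ Z ∈ ball (0 : Cz n) ε,
      dirDeriv wUnit (fun Z => ρ Z χ) Z ≠ 0 := fun χ hχ Z hZ => by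
    rw [hgw_eq (Z, χ) ⟨hεr hZ, hεr hχ⟩]
    exact hw₁ (Z, χ) ⟨hεε₁ hZ, hεε₁ hχ⟩
  have hz0 : (0 : Cz n) ∈ ball (0 : Cz n) ε := mem_ball_self hεpos
  let ι := {ζ : Cz n // ζ ∈ segreVariety U ρ 0 ∩ ball 0 ε}
  have hι : Nonempty ι := ⟨⟨0, ⟨h0, by rw [star_zero]; exact hρ0⟩, hz0⟩⟩
  have hχ : ∀ ζ : ι, star ζ.1 ∈ ball (0 : Cz n) ε := fun ζ => star_mem_ball_iff.2 ζ.2.2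
  -- Reality turns ρ(ζ, 0) = 0 into ρ(0, ζ̄) = 0, so the hypersurface {ρ(·, ζ̄) = 0} passes through
  -- 0.
  have hρχ : ∀ ζ : ι, ρ 0 (star ζ.1) = 0 := by
    intro ζ
    have h1 := star_eq_of_real_on_conj hgd hreal 0 (mem_ball_self hr) (star ζ.1) (hεr (hχ ζ))
    have h2 : ρ ζ.1 (star 0) = 0 := ζ.2.1.2
    rw [star_star] at h1
    change star (ρ ζ.1 (star 0)) = ρ 0 (star ζ.1) at h1
    rw [← h1, h2, star_zero]
  let x : ι → (Fin n → ℕ) × ℕ → ℂ := fun ζ v => mixedPartial v.1 v.2 (fun Z => ρ Z (star ζ.1)) 0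
  have hjet : ∀ ζ : ι, ∀ v : (Fin n → ℕ) × ℕ, 0 < order v.1 + v.2 →
      mixedPartial v.1 v.2 (fun Z => quadricPullback L A H (Z, star ζ.1)) 0 =
        ν (star ζ.1) (jetVector H v) := fun ζ v hv =>
    mixedPartial_form hr hHd (ν (star ζ.1))
      ((2 * Complex.I)⁻¹ * star (L (H (star (star ζ.1)))).2) hv
  have hq : ∀ j, order (α j) = (order (α j) - 1) + 1 := fun j => by have := hα j; omega
  -- Chosen before ζ enters: the same polynomials serve every ζ.
  choose S G hS hG hrel using fun j => exists_tangential_relation (order (α j) - 1) (α j) (hq j)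
  have e2 : ∀ j, 2 * (order (α j) - 1) = 2 * order (α j) - 2 := fun j => by omega
  have e1 : ∀ j, 2 * (order (α j) - 1) + 1 = 2 * order (α j) - 1 := fun j => by
    have := hα j; omega
  obtain ⟨k, l, hk, hl, P, R, hPR, ⟨j, hjk, ζ, hζ⟩, hP, hR⟩ := exists_polynomial_relation
    (m := m) (by simp) T.toLinearMap hTinj (jetVector H) x (fun ζ => ν (star ζ.1))
    (fun ζ => by
      have := hfw _ (hχ ζ) 0 hz0
      rwa [← mixedPartial_zero_one] at this)
    (fun ζ => hν₂ _ (hεε₂ (hχ ζ)))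
    (fun ζ p => by
      have h1 := htan (star ζ.1) (hεrδ (hχ ζ)) (hρχ ζ) (hfw _ (hχ ζ) 0 hz0) p
      have h2 : fderiv ℂ (fun Z => ρ Z (star ζ.1)) 0 p =
          ∑ j, x ζ (Pi.single j 1, 0) * p.1 j + x ζ (0, 1) * p.2 := by
        have hp : p = ∑ j, p.1 j • zUnit j + p.2 • wUnit := by
          refine Prod.ext ?_ ?_
          · ext i
            simp [zUnit, wUnit, Prod.fst_sum, Finset.sum_apply, Pi.single_apply]
          · simp [zUnit, wUnit, Prod.snd_sum]
        conv_lhs => rw [hp]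
        rw [map_add, map_sum, map_smul, smul_eq_mul, mul_comm p.2]
        congr 1
        · refine Finset.sum_congr rfl fun j _ => ?_
          rw [map_smul, smul_eq_mul, mul_comm]
          congr 1
          exact (mixedPartial_single isOpen_ball (hslice _ (hεr (hχ ζ))) j
            (mem_ball_self hr)).symm
        · congr 1
          simp only [x]
          rw [mixedPartial_zero_one]
          rfl
      have h3 : x ζ (0, 1) = dirDeriv wUnit (fun Z => ρ Z (star ζ.1)) 0 := by
        simp only [x]
        rw [mixedPartial_zero_one]
      rw [← h2, h3]
      exact h1)
    α hα S G (fun j c hc => by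
      have := (hS j c hc).1
      rwa [← hq j, e2 j] at this) (fun j => by
      have := hG j
      rwa [← hq j, e1 j] at this)
    (fun ζ j => by
      have h1 := hrel j (ball 0 ε) (fun Z => ρ Z (star ζ.1))
        (fun Z => quadricPullback L A H (Z, star ζ.1)) isOpen_ball
        ((hslice _ (hεr (hχ ζ))).mono hεr) ((hslice' _ (hεr (hχ ζ))).mono hεr) (hfw _ (hχ ζ))
        (fun Z hZ h => hQ Z (hεδ hZ) _ (hεδ (hχ ζ)) h) 0 hz0 (hρχ ζ)
      have h2 : evalList (fun Z => ρ Z (star ζ.1)) (fun Z => quadricPullback L A H (Z, star ζ.1)) 0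
          (S j) = ν (star ζ.1) (vectorValue (x ζ) (jetVector H) (S j)) := by
        rw [apply_vectorValue, evalList]
        congr 1
        refine List.map_congr_left fun c hc => ?_
        rw [hjet ζ c.2 (hS j c hc).2]
        rfl
      have h3 : dirDeriv wUnit (fun Z => quadricPullback L A H (Z, star ζ.1)) 0 =
          ν (star ζ.1) (T wUnit) := by
        rw [dirDeriv, (hF' _).fderiv]
        rfl
      rw [h2, h3, e2 j, ← mixedPartial_zero_one] at h1
      exact h1)
  exact ⟨ε, hεpos, k, l, hk, hl, P, R, fun ζ hζ => hPR ⟨ζ, hζ⟩, ⟨j, hjk, ζ.1, ζ.2.1, hζ⟩, hP, hR⟩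

end Embedding

end Segre

/-! ### Propagation from a neighbourhood of 0 to the whole Segre variety. -/

theorem theorem2p2 (n m : ℕ) (U : Set (Segre.Cz n)) (hU : IsOpen U) (h0 : (0 : Segre.Cz n) ∈ U)
    (ρ : Segre.Cz n → Segre.Cz n → ℂ) (hρ : Segre.IsComplexifiedRealAnalytic U ρ)
    (hρ0 : ρ 0 0 = 0)
    (hρw : Segre.mixedPartial 0 1 (fun Z => ρ Z 0) 0 ≠ 0)
    (hS : Segre.SegreIrreducible U ρ 0)
    (hemb : Segre.TransversallyEmbeddable (Segre.hypersurface U ρ) (n + m))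
    (α : Fin (m + 1) → Fin n → ℕ) (hα : ∀ j, 2 ≤ Segre.order (α j)) :
    ∃ k l : ℕ,
      (∃ j, Segre.order (α j) = k) ∧
      l = (Finset.univ.filter (fun j => Segre.order (α j) ≤ k)).card ∧
      ∃ (P : Fin (m + 1) → Segre.JetPoly n) (R : Segre.JetPoly n),
        (∀ ζ ∈ Segre.segreVariety U ρ 0,
          ∑ j ∈ Finset.univ.filter (fun j => Segre.order (α j) = k),
            (P j).evalAt ρ ζ * Segre.mixedPartial (α j) 0 (fun Z => ρ Z (star ζ)) 0
            = R.evalAt ρ ζ) ∧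
        (∃ j, Segre.order (α j) = k ∧
          ∃ ζ ∈ Segre.segreVariety U ρ 0, (P j).evalAt ρ ζ ≠ 0) ∧
        (∀ j, Segre.order (α j) = k →
          (P j).LowerOrder k ∧ (P j).wt ≤ (2 * k - 2) * (l - 1) ∧
          (P j).degW ≤ (2 * k - 2) * l) ∧
        R.LowerOrder k ∧ R.wt ≤ (2 * k - 2) * l + 1 ∧ R.degW ≤ (2 * k - 2) * l + 1 := by
  obtain ⟨ε, hε, k, l, hk, hl, P, R, hPR, hne, hP, hR⟩ :=
    Segre.exists_relation_near_zero hU h0 hρ hρ0 hρw hemb α hα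
  refine ⟨k, l, hk, hl, P, R, ?_, hne, fun j _ => ⟨Segre.lowerOrder_of_mem_jetLE (hP j),
    Segre.wt_le_of_mem_jetLE (hP j), Segre.degW_le_of_mem_jetLE (hP j)⟩,
    Segre.lowerOrder_of_mem_jetLE hR, Segre.wt_le_of_mem_jetLE hR, Segre.degW_le_of_mem_jetLE hR⟩
  -- The relation as a single polynomial. The conjugate of its value is holomorphic in ζ, so the
  -- identity theorem on S_0 applies, starting at 0, which is a regular point because ρ_w(0, 0) ≠ 0.
  let T : Segre.JetPoly n := ∑ j ∈ Finset.univ.filter (fun j => Segre.order (α j) = k),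
    P j * MvPolynomial.X (α j, 0) - R
  have hT : ∀ ζ, T.evalAt ρ ζ = ∑ j ∈ Finset.univ.filter (fun j => Segre.order (α j) = k),
      (P j).evalAt ρ ζ * Segre.mixedPartial (α j) 0 (fun Z => ρ Z (star ζ)) 0 - R.evalAt ρ ζ := by
    intro ζ
    simp [T, Segre.JetPoly.evalAt]
  have hf : DifferentiableOn ℂ (fun Z => ρ Z (star 0)) U :=
    hρ.holo.comp (f := fun Z => (Z, star (0 : Segre.Cz n))) (by fun_prop)
      fun Z hZ => ⟨hZ, by simpa using h0⟩
  have hp₀ : (0 : Segre.Cz n) ∈ Segre.segreRegular U ρ 0 := by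
    refine ⟨⟨h0, by rw [star_zero]; exact hρ0⟩, fun h => hρw ?_⟩
    rw [Segre.mixedPartial_zero_one, Segre.dirDeriv]
    rw [star_zero] at h
    rw [h]
    rfl
  have hzero := Segre.eqOn_zero_of_irreducible hU hf
    (Segre.differentiableOn_star_evalAt hU h0 hρ T) hS.1.isPreconnected hS.2 hp₀ (by
      filter_upwards [Metric.ball_mem_nhds (0 : Segre.Cz n) hε] with ζ hζ hζU hζ0
      rw [hT, hPR ζ ⟨⟨hζU, hζ0⟩, hζ⟩, sub_self, star_zero])
  intro ζ hζ
  have := hzero ζ hζ.1 hζ.2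
  rw [star_eq_zero, hT] at this
  exact sub_eq_zero.1 this
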